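/- Let $n\ge 2$, $p\ge 0$, $m=n+p$. Let $M$ be a (Hausdorff) smooth $m$-dimensional Riemannian manifold with metric $\bar g$, Levi-Civita connection $\bar\nabla$ and curvature tensor $\bar R(X,Y)Z=\bar\nabla_X\bar\nabla_YZ-\bar\nabla_Y\bar\nabla_XZ-\bar\nabla_{[X,Y]}Z$, and let $\Sigma$ be a smooth $n$-dimensional manifold smoothly embedded in $M$. Let $x^1,\dots,x^m$ be local coordinates on $M$ and $u^1,\dots,u^n$ local coordinates on $\Sigma$; everything below is considered on the part of $\Sigma$ where both are defined, where $x^i$ denotes also the function $x^i(u)$ giving the embedding, $\partial_a=\partial/\partial u^a$, $\partial_i=\partial/\partial x^i$, and $\bar\Gamma^i_{jk}$, the Christoffel symbols of $\bar g$, are regarded as functions on $\Sigma$. Repeated indices are summed. Put $e_a=(\partial_ax^i)\partial_i$, $g_{ab}=\bar g(e_a,e_b)$, and let $\nabla$ be the Levi-Civita connection of $g$. Let $N_A=n_A^i\partial_i$ $(A=1,\dots,p)$ be smooth orthonormal normal vector fields of $\Sigma$, and define the second fundamental forms, the Weingarten maps and the normal connection by $h_A(X,Y)=\bar g(\bar\nabla_XY,N_A)$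 and $\bar\nabla_XN_A=-W_A(X)+D_XN_A$ with $W_A(X)$ tangent and $D_XN_A$ normal to $\Sigma$, for $X,Y$ tangent to $\Sigma$. Let $\rho$ be a non-vanishing density on $\Sigma$, let $\gamma=\sqrt{\det(g_{ab})}/\rho$, and define for $f_1,\dots,f_n\in C^\infty(\Sigma)$ the Nambu bracket $$\{f_1,\dots,f_n\}=\frac1\rho\,\varepsilon^{a_1\cdots a_n}(\partial_{a_1}f_1)\cdots(\partial_{a_n}f_n),$$ and, for given $f_1,\dots,f_{n-2}$, $\{g_1,g_2\}_f=\{g_1,g_2,f_1,\dots,f_{n-2}\}$. For multi-indices $I=i_1\cdots i_{n-1}$, $J=j_1\cdots j_{n-1}$ with entries in $\{1,\dots,m\}$ put $\mathcal P^{iJ}=\frac1{\sqrt{(n-1)!}}\{x^i,x^{j_1},\dots,x^{j_{n-1}}\}$ and $(\mathcal P^2)^i{}_j=\mathcal P^{iI}\mathcal P^{lJ}\,\bar g_{i_1j_1}\cdots\bar g_{i_{n-1}j_{n-1}}\,\bar g_{lj}$. Finally let $$\mathcal W_A(X,Y)=(\nabla_XW_A)(Y)-(\nabla_YW_A)(X)+\sum_{B=1}^p\big[\bar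 g(D_XN_B,N_A)W_B(Y)-\bar g(D_YN_B,N_A)W_B(X)\big],$$ $$\mathcal C_A(f_1,\dots,f_{n-2})=\frac1{2\rho}\,\varepsilon^{aba_1\cdots a_{n-2}}\,\mathcal W_A(e_a,e_b)\,(\partial_{a_1}f_1)\cdots(\partial_{a_{n-2}}f_{n-2}).$$ Then the following hold. 1. For all $A$ and all $f_1,\dots,f_{n-2}\in C^\infty(\Sigma)$, $$\gamma^2\,\mathcal C_A(f_1,\dots,f_{n-2})=(\mathcal P^2)^i{}_j\Big[\{x^k,\bar\Gamma^j_{kj'}\}_f-\{x^k,x^l\}_f\,\bar\Gamma^m_{lj'}\bar\Gamma^j_{km}\Big]n_A^{j'}\,\partial_i.\qquad(*)$$ 2. For every $A$ and at every point, the identity $(*)$ for all $f_1,\dots,f_{n-2}\in C^\infty(\Sigma)$ is equivalent to the Codazzi–Mainardi equation: for all tangent vectors $X,Y,Z$ of $\Sigma$, $$\bar g(\bar R(X,Y)Z,N_A)=(\nabla_Xh_A)(Y,Z)-(\nabla_Yh_A)(X,Z)+\sum_{B=1}^p\big[\bar g(D_XN_B,N_A)h_B(Y,Z)-\bar g(D_YN_B,N_A)h_B(X,Z)\big].$$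 3. This equivalence is formal: it remains true when, in both of its sides, the $W_B$ are replaced by arbitrary smooth fields of endomorphisms of $T\Sigma$, the $h_B(X,Y)$ by $g(W_B(X),Y)$, and the $\bar g(D_XN_B,N_A)$ by arbitrary one-forms $\theta_{BA}(X)$. 4. If $M$ has constant (sectional) curvature, then $\mathcal C_A(f_1,\dots,f_{n-2})=0$ for all $A$ and all $f_1,\dots,f_{n-2}\in C^\infty(\Sigma)$. -/

import Mathlib

open scoped Manifold ContDiff

noncomputable section

namespace NambuCodazzi

/-! ## Riemannian geometry in coordinates -/

/-- The partial derivative `∂ f / ∂ u^a` at the point `u`. -/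
def pd {n : ℕ} (f : EuclideanSpace ℝ (Fin n) → ℝ) (a : Fin n)
    (u : EuclideanSpace ℝ (Fin n)) : ℝ :=
  fderiv ℝ f u (EuclideanSpace.single a 1)

/-- The value `∑ G_ij V^i W^j` of a bilinear form with coefficients `G_ij`. -/
def pairing {n : ℕ} (G : Matrix (Fin n) (Fin n) ℝ) (V W : Fin n → ℝ) : ℝ :=
  ∑ i, ∑ j, G i j * V i * W j

/-- The Christoffel symbol `Γ^i_jk` of the Levi-Civita connection of the metric with
components `G_ij`, at the point `y`. -/
def christoffel {n : ℕ} (G : EuclideanSpace ℝ (Fin n) → Matrix (Fin n) (Fin n) ℝ)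
    (y : EuclideanSpace ℝ (Fin n)) (i j k : Fin n) : ℝ :=
  (1 / 2) * ∑ l, (G y)⁻¹ i l *
    (pd (fun z => G z l k) j y + pd (fun z => G z l j) k y - pd (fun z => G z j k) l y)

/-- The component `R^i_jkl` of the Riemann curvature tensor, defined by
`R(∂_k, ∂_l) ∂_j = R^i_jkl ∂_i`, where
`R(X, Y) Z = ∇_X ∇_Y Z - ∇_Y ∇_X Z - ∇_[X,Y] Z`. -/
def riemann {n : ℕ} (G : EuclideanSpace ℝ (Fin n) → Matrix (Fin n) (Fin n) ℝ)
    (y : EuclideanSpace ℝ (Fin n)) (i j k l : Fin n) : ℝ :=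
  pd (fun z => christoffel G z i l j) k y - pd (fun z => christoffel G z i k j) l y
    + ∑ q, (christoffel G y i k q * christoffel G y q l j
        - christoffel G y i l q * christoffel G y q k j)

/-- The vector `R(X, Y) Z` at the point `y`, in components. -/
def curvature {n : ℕ} (G : EuclideanSpace ℝ (Fin n) → Matrix (Fin n) (Fin n) ℝ)
    (y : EuclideanSpace ℝ (Fin n)) (X Y Z : Fin n → ℝ) : Fin n → ℝ :=
  fun i => ∑ j, ∑ k, ∑ l, riemann G y i j k l * X k * Y l * Z j

/-! ## Submanifolds in coordinates

A submanifold of dimension `n`, with local coordinates `u^1, …, u^n`, in a Riemannian manifold of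
dimension `m`, with local coordinates `x^1, …, x^m`, together with `p` vector fields `N_A` along
the submanifold and a density on it. -/

/-- The coordinate expressions of the objects listed above; they are instantiated below, by
`coordExpr`, with those of an embedding into a Riemannian manifold. -/
structure CoordExpr (n m p : ℕ) where
  /-- the components of the metric of the ambient manifold -/
  metric : EuclideanSpace ℝ (Fin m) → Matrix (Fin m) (Fin m) ℝ
  /-- the embedding `u ↦ (x^1(u), …, x^m(u))` -/
  x : EuclideanSpace ℝ (Fin n) → EuclideanSpace ℝ (Fin m)
  /-- the components `n_A^i(u)` of `N_A` -/
  normal : Fin p → EuclideanSpace ℝ (Fin n) → Fin m → ℝ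
  /-- the density `ρ(u)` -/
  density : EuclideanSpace ℝ (Fin n) → ℝ

namespace CoordExpr

variable {n m p : ℕ} (D : CoordExpr n m p)

/-- The components of the ambient metric along the submanifold. -/
def gBar (u : EuclideanSpace ℝ (Fin n)) : Matrix (Fin m) (Fin m) ℝ := D.metric (D.x u)

/-- The ambient Christoffel symbols along the submanifold, `Γ^i_jk(x(u))`. -/
def GammaBar (i j k : Fin m) (u : EuclideanSpace ℝ (Fin n)) : ℝ :=
  christoffel D.metric (D.x u) i j k

/-- The components of the tangent vector `e_a = (∂_a x^i) ∂_i`. -/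
def e (a : Fin n) (u : EuclideanSpace ℝ (Fin n)) : Fin m → ℝ :=
  fun i => pd (fun v => D.x v i) a u

/-- The tangent vector `X^a e_a`. -/
def push (u : EuclideanSpace ℝ (Fin n)) (X : Fin n → ℝ) : Fin m → ℝ :=
  fun i => ∑ a, X a * D.e a u i

/-- The induced metric `g_ab`. -/
def g (u : EuclideanSpace ℝ (Fin n)) : Matrix (Fin n) (Fin n) ℝ :=
  Matrix.of fun a b => pairing (D.gBar u) (D.e a u) (D.e b u)

/-- The Christoffel symbols `Γ^c_ab` of the induced metric. -/
def Gamma (u : EuclideanSpace ℝ (Fin n)) (c a b : Fin n) : ℝ := christoffel D.g u c a b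

/-- The ambient covariant derivative, in the direction `e_a`, of a vector field `V` along the
submanifold: its components are `∂_a V^i + Γ^i_jk (∂_a x^j) V^k`. -/
def nablaBar (V : EuclideanSpace ℝ (Fin n) → Fin m → ℝ) (a : Fin n)
    (u : EuclideanSpace ℝ (Fin n)) : Fin m → ℝ :=
  fun i => pd (fun v => V v i) a u + ∑ j, ∑ k, D.GammaBar i j k u * D.e a u j * V u k

/-- The second fundamental forms: `h_{A,ab}` is the inner product of `N_A` with the ambient
covariant derivative of `e_b` in the direction `e_a`. -/
def h (A : Fin p) (u : EuclideanSpace ℝ (Fin n)) : Matrix (Fin n) (Fin n) ℝ :=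
  Matrix.of fun a b => pairing (D.gBar u) (D.nablaBar (D.e b) a u) (D.normal A u)

/-- The Weingarten maps: `(W_A)^a_b e_a` is the tangential component of minus the ambient covariant
derivative of `N_A` in the direction `e_b`. -/
def W (A : Fin p) (u : EuclideanSpace ℝ (Fin n)) : Matrix (Fin n) (Fin n) ℝ :=
  Matrix.of fun a b =>
    -∑ c, (D.g u)⁻¹ a c * pairing (D.gBar u) (D.nablaBar (D.normal A) b u) (D.e c u)

/-- The covariant derivative `D_{e_a} N_B` in the normal bundle, from Weingarten's formula: the
ambient covariant derivative of `N_B` is `-W_B(e_a) + D_{e_a} N_B`. -/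
def normalDeriv (B : Fin p) (a : Fin n) (u : EuclideanSpace ℝ (Fin n)) : Fin m → ℝ :=
  fun i => D.nablaBar (D.normal B) a u i + ∑ b, D.W B u b a * D.e b u i

/-- The coefficients of the normal connection: the inner product of `D_{e_a} N_B` with `N_A`. -/
def normalConn (B A : Fin p) (u : EuclideanSpace ℝ (Fin n)) (a : Fin n) : ℝ :=
  pairing (D.gBar u) (D.normalDeriv B a u) (D.normal A u)

/-- The components `(∇_c T)_ab` of the covariant derivative, with respect to the induced metric, of
a field `T` of bilinear forms. -/
def nablaForm (T : EuclideanSpace ℝ (Fin n) → Matrix (Fin n) (Fin n) ℝ)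
    (u : EuclideanSpace ℝ (Fin n)) (c a b : Fin n) : ℝ :=
  pd (fun v => T v a b) c u - ∑ d, D.Gamma u d c a * T u d b - ∑ d, D.Gamma u d c b * T u a d

/-- The components `(∇_c T)^a_b` of the covariant derivative, with respect to the induced metric,
of a field `T` of endomorphisms. -/
def nablaEnd (T : EuclideanSpace ℝ (Fin n) → Matrix (Fin n) (Fin n) ℝ)
    (u : EuclideanSpace ℝ (Fin n)) (c a b : Fin n) : ℝ :=
  pd (fun v => T v a b) c u + ∑ d, D.Gamma u a c d * T u d b - ∑ d, D.Gamma u d c b * T u a d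

/-- The Codazzi–Mainardi equation with index `A` at the point `u`, for fields of bilinear forms
`h_B` and one-forms `θ_BA` in the place of the second fundamental forms and of the normal
connection: for all tangent vectors `X`, `Y`, `Z`, the inner product of `R(X, Y) Z` with `N_A` is
`(∇_X h_A)(Y, Z) - (∇_Y h_A)(X, Z) + ∑_B (θ_BA(X) h_B(Y, Z) - θ_BA(Y) h_B(X, Z))`. -/
def CodazziMainardi (h : Fin p → EuclideanSpace ℝ (Fin n) → Matrix (Fin n) (Fin n) ℝ)
    (θ : Fin p → Fin p → EuclideanSpace ℝ (Fin n) → Fin n → ℝ)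
    (A : Fin p) (u : EuclideanSpace ℝ (Fin n)) : Prop :=
  ∀ X Y Z : Fin n → ℝ,
    pairing (D.gBar u)
        (curvature D.metric (D.x u) (D.push u X) (D.push u Y) (D.push u Z)) (D.normal A u)
      = ∑ a, ∑ b, ∑ c, X a * Y b * Z c *
          (D.nablaForm (h A) u a b c - D.nablaForm (h A) u b a c
            + ∑ B, (θ B A u a * h B u b c - θ B A u b * h B u a c))

/-- The components, in the basis `e_c`, of
`𝒲_A(e_a, e_b) = (∇_a W_A)(e_b) - (∇_b W_A)(e_a) + ∑_B (θ_BA(e_a) W_B(e_b) - θ_BA(e_b) W_B(e_a))`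
for fields of endomorphisms `W_B` and one-forms `θ_BA`. -/
def calW (W : Fin p → EuclideanSpace ℝ (Fin n) → Matrix (Fin n) (Fin n) ℝ)
    (θ : Fin p → Fin p → EuclideanSpace ℝ (Fin n) → Fin n → ℝ)
    (A : Fin p) (u : EuclideanSpace ℝ (Fin n)) (a b : Fin n) : Fin n → ℝ :=
  fun c => D.nablaEnd (W A) u a c b - D.nablaEnd (W A) u b c a
    + ∑ B, (θ B A u a * W B u c b - θ B A u b * W B u c a)

/-- The Nambu bracket `{F_1, …, F_n} = (1/ρ) ε^{a_1 ⋯ a_n} (∂_{a_1} F_1) ⋯ (∂_{a_n} F_n)`; only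
the permutations contribute to the sum over `a_1, …, a_n`. -/
def bracket (F : Fin n → EuclideanSpace ℝ (Fin n) → ℝ) (u : EuclideanSpace ℝ (Fin n)) : ℝ :=
  1 / D.density u *
    ∑ σ : Equiv.Perm (Fin n), ((Equiv.Perm.sign σ : ℤ) : ℝ) * ∏ a, pd (F a) (σ a) u

/-- The function `γ = √(det g) / ρ`. -/
def gamma (u : EuclideanSpace ℝ (Fin n)) : ℝ := √(D.g u).det / D.density u

end CoordExpr

namespace CoordExpr

variable {k m p : ℕ} (D : CoordExpr (k + 2) m p)

/-- `{g₁, g₂}_f = {g₁, g₂, f_1, …, f_{n-2}}`, where `n = k + 2`. -/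
def bracketWith (f : Fin k → EuclideanSpace ℝ (Fin (k + 2)) → ℝ)
    (g₁ g₂ : EuclideanSpace ℝ (Fin (k + 2)) → ℝ) (u : EuclideanSpace ℝ (Fin (k + 2))) : ℝ :=
  D.bracket (Matrix.vecCons g₁ (Matrix.vecCons g₂ f)) u

/-- `𝒫^{iJ} = {x^i, x^{j_1}, …, x^{j_{n-1}}} / √((n-1)!)`, where `n = k + 2`. -/
def P (u : EuclideanSpace ℝ (Fin (k + 2))) (i : Fin m) (J : Fin (k + 1) → Fin m) : ℝ :=
  1 / √((k + 1).factorial : ℝ) *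
    D.bracket (Matrix.vecCons (fun v => D.x v i) fun t v => D.x v (J t)) u

/-- `(𝒫²)^{il} = 𝒫^{iI} 𝒫^{lJ} g_{IJ}`, with `g_{IJ}` the product of the ambient metric
components `g_{i_t j_t}`. -/
def PSqUpper (u : EuclideanSpace ℝ (Fin (k + 2))) (i l : Fin m) : ℝ :=
  ∑ I : Fin (k + 1) → Fin m, ∑ J : Fin (k + 1) → Fin m,
    D.P u i I * D.P u l J * ∏ t, D.gBar u (I t) (J t)

/-- `(𝒫²)^i_j`, with the second index lowered by the ambient metric. -/
def PSq (u : EuclideanSpace ℝ (Fin (k + 2))) (i j : Fin m) : ℝ :=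
  ∑ l, D.PSqUpper u i l * D.gBar u l j

/-- The components in the ambient coordinates of
`𝒞_A(f_1, …, f_{n-2}) =
  (1/(2ρ)) ε^{a b a_1 ⋯ a_{n-2}} 𝒲_A(e_a, e_b) (∂_{a_1} f_1) ⋯ (∂_{a_{n-2}} f_{n-2})`,
where `n = k + 2`, for fields of endomorphisms `W_B` and one-forms `θ_BA`. -/
def calC (W : Fin p → EuclideanSpace ℝ (Fin (k + 2)) → Matrix (Fin (k + 2)) (Fin (k + 2)) ℝ)
    (θ : Fin p → Fin p → EuclideanSpace ℝ (Fin (k + 2)) → Fin (k + 2) → ℝ)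
    (A : Fin p) (f : Fin k → EuclideanSpace ℝ (Fin (k + 2)) → ℝ)
    (u : EuclideanSpace ℝ (Fin (k + 2))) : Fin m → ℝ :=
  fun i => 1 / (2 * D.density u) *
    ∑ σ : Equiv.Perm (Fin (k + 2)), ((Equiv.Perm.sign σ : ℤ) : ℝ) *
      D.push u (D.calW W θ A u (σ 0) (σ 1)) i * ∏ l : Fin k, pd (f l) (σ l.succ.succ) u

/-- The identity
`γ² 𝒞_A(f_1, …, f_{n-2})
  = (𝒫²)^i_j [{x^l, Γ^j_{lj'}}_f - {x^l, x^q}_f Γ^r_{qj'} Γ^j_{lr}] n_A^{j'} ∂_i`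
at the point `u`. -/
def NambuIdentity
    (W : Fin p → EuclideanSpace ℝ (Fin (k + 2)) → Matrix (Fin (k + 2)) (Fin (k + 2)) ℝ)
    (θ : Fin p → Fin p → EuclideanSpace ℝ (Fin (k + 2)) → Fin (k + 2) → ℝ)
    (A : Fin p) (f : Fin k → EuclideanSpace ℝ (Fin (k + 2)) → ℝ)
    (u : EuclideanSpace ℝ (Fin (k + 2))) : Prop :=
  ∀ i : Fin m,
    D.gamma u ^ 2 * D.calC W θ A f u i
      = ∑ j, D.PSq u i j * ∑ j',
          (∑ l, D.bracketWith f (fun v => D.x v l) (D.GammaBar j l j') u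
            - ∑ l, ∑ q, ∑ r, D.bracketWith f (fun v => D.x v l) (fun v => D.x v q) u
                * D.GammaBar r q j' u * D.GammaBar j l r u)
          * D.normal A u j'

end CoordExpr

/-! ## Submanifolds of Riemannian manifolds -/

/-- A smooth Riemannian metric on `M`. -/
abbrev Metric (m : ℕ) (M : Type*) [TopologicalSpace M]
    [ChartedSpace (EuclideanSpace ℝ (Fin m)) M] [IsManifold (𝓡 m) ∞ M] :=
  Bundle.ContMDiffRiemannianMetric (𝓡 m) ∞ (EuclideanSpace ℝ (Fin m))
    (fun q : M => TangentSpace (𝓡 m) q)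

section Ambient

variable {m : ℕ} {M : Type*} [TopologicalSpace M] [ChartedSpace (EuclideanSpace ℝ (Fin m)) M]
  [IsManifold (𝓡 m) ∞ M]

/-- The components `g_ij` of a Riemannian metric in the chart `φ`, as functions of the
coordinates. -/
def metricInChart (gM : Metric m M) (φ : OpenPartialHomeomorph M (EuclideanSpace ℝ (Fin m)))
    (y : EuclideanSpace ℝ (Fin m)) : Matrix (Fin m) (Fin m) ℝ :=
  Matrix.of fun i j =>
    gM.inner (φ.symm y)
      (mfderiv (𝓡 m) (𝓡 m) φ.symm y (EuclideanSpace.single i (1 : ℝ) : EuclideanSpace ℝ (Fin m)))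
      (mfderiv (𝓡 m) (𝓡 m) φ.symm y (EuclideanSpace.single j (1 : ℝ) : EuclideanSpace ℝ (Fin m)))

/-- All sectional curvatures of `M` are equal to `K`: the inner product of `R(X, Y) Y` with `X` is
`K (|X|² |Y|² - ⟨X, Y⟩²)`. -/
def HasConstantCurvature (gM : Metric m M) (K : ℝ) : Prop :=
  ∀ φ ∈ IsManifold.maximalAtlas (𝓡 m) ∞ M, ∀ y ∈ φ.target, ∀ X Y : Fin m → ℝ,
    pairing (metricInChart gM φ y) (curvature (metricInChart gM φ) y X Y Y) X
      = K * (pairing (metricInChart gM φ y) X X * pairing (metricInChart gM φ y) Y Y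
          - pairing (metricInChart gM φ y) X Y ^ 2)

variable {n p : ℕ} {S : Type*} [TopologicalSpace S] [ChartedSpace (EuclideanSpace ℝ (Fin n)) S]

variable (n) in
/-- On the open set `U`, the vector fields `N_A` along `ι` are smooth, orthonormal and normal to
the submanifold. -/
structure IsNormalFrameOn (gM : Metric m M) (ι : S → M)
    (N : Fin p → ∀ s : S, TangentSpace (𝓡 m) (ι s)) (U : Set S) : Prop where
  smooth : ∀ A, ContMDiffOn (𝓡 n) (𝓡 m).tangent ∞
    (fun s => (⟨ι s, N A s⟩ : TangentBundle (𝓡 m) M)) U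
  orthonormal : ∀ s ∈ U, ∀ A B, gM.inner (ι s) (N A s) (N B s) = if A = B then 1 else 0
  normal : ∀ s ∈ U, ∀ A, ∀ v : TangentSpace (𝓡 n) s,
    gM.inner (ι s) (N A s) (mfderiv (𝓡 n) (𝓡 m) ι s v) = 0

/-- The coordinate expressions of an embedding `ι`, of vector fields `N_A` along it and of a density
`ρ` (given through its values in the chart `ψ`), in a chart `ψ` of the submanifold and a chart `φ`
of the ambient manifold. -/
def coordExpr (gM : Metric m M) (ι : S → M) (N : Fin p → ∀ s : S, TangentSpace (𝓡 m) (ι s))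
    (φ : OpenPartialHomeomorph M (EuclideanSpace ℝ (Fin m)))
    (ψ : OpenPartialHomeomorph S (EuclideanSpace ℝ (Fin n))) (ρ : S → ℝ) : CoordExpr n m p where
  metric := metricInChart gM φ
  x := fun u => φ (ι (ψ.symm u))
  normal := fun A u i =>
    (EuclideanSpace.proj i : EuclideanSpace ℝ (Fin m) →L[ℝ] ℝ)
      (mfderiv (𝓡 m) (𝓡 m) φ (ι (ψ.symm u)) (N A (ψ.symm u)))
  density := fun u => ρ (ψ.symm u)

/-- The functions `f_1, …, f_k` on the submanifold, as functions of the coordinates given by the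
chart `ψ`. -/
def inCoords {k : ℕ} (ψ : OpenPartialHomeomorph S (EuclideanSpace ℝ (Fin n)))
    (f : Fin k → C^∞⟮𝓡 n, S; ℝ⟯) : Fin k → EuclideanSpace ℝ (Fin n) → ℝ :=
  fun l u => f l (ψ.symm u)

end Ambient

end NambuCodazzi

end

open NambuCodazzi

namespace NambuCodazzi

open Matrix

/-! ### Partial derivatives -/

section Calculus

variable {n m : ℕ} {f g : EuclideanSpace ℝ (Fin n) → ℝ} {u : EuclideanSpace ℝ (Fin n)}

/-! Both sides of the identity are tangent to Σ, and everything reduces to linear algebra at one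
point once three facts are known.

The operator `𝒫²` is `γ²` times the orthogonal projection onto `TΣ`. Contracting two ε-symbols with
`n - 1` copies of `g_ab` gives `(n - 1)!` times the adjugate of `g`, that is `(n - 1)! det(g) g⁻¹`
(`sum_perm_sum_perm`, `PSqUpper_eq_adjugate`, `sum_PSq_mul`).

The bracket expression on the right contracts ε with a matrix in the slots `a, b`, so only its skew
part counts. There the second derivatives of `x` cancel, and what remains is the pulled-back
curvature form, `-R(e_a, e_b)` (`riemann_comp`, `bracketMatrix_sub`).

Curvature operators are skew-adjoint, so the tangential part of `-R(e_a, e_b) N_A` is the vector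
dual to `Z ↦ ⟨R(e_a, e_b) Z, N_A⟩`. Hence the identity says that ε annihilates `𝒲_A(e_a, e_b)` minus
that vector, contracted with the `∂f` (`nambuIdentity_iff`). Since functions with arbitrary first
derivatives at a point exist, the identity for all `f` means that this difference, skew in `a, b`,
is zero (`eq_zero_of_sum_perm_eq_zero`). Lowering the index with the parallel metric `g` turns this
into the Codazzi–Mainardi equation (`codazziMainardi_iff_nambuIdentity`). Nothing here depends on
the origin of `W` and `θ`, so the equivalence is formal.

The identity itself then follows from the classical Codazzi–Mainardi equation (`codazziMainardi`),
obtained by commuting two covariant derivatives of `N_A`. For constant curvature, `R(X, Y) Z` lies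
in the span of `X` and `Y` (`curvature_of_const`), so its pairing with `N_A` vanishes, and with it
`𝒲_A` and `𝒞_A`. `isRegular_coordExpr` carries the manifold hypotheses over to coordinates. -/

lemma pd_add (hf : DifferentiableAt ℝ f u) (hg : DifferentiableAt ℝ g u) (a : Fin n) :
    pd (fun v => f v + g v) a u = pd f a u + pd g a u := by
  simp [pd, fderiv_fun_add hf hg]

lemma pd_neg (a : Fin n) : pd (fun v => -f v) a u = -pd f a u := by
  simp [pd, fderiv_fun_neg]

lemma pd_mul (hf : DifferentiableAt ℝ f u) (hg : DifferentiableAt ℝ g u) (a : Fin n) :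
    pd (fun v => f v * g v) a u = pd f a u * g u + f u * pd g a u := by
  simp [pd, fderiv_fun_mul hf hg]; ring

lemma pd_sum {ι : Type*} (s : Finset ι) {F : ι → EuclideanSpace ℝ (Fin n) → ℝ}
    (hF : ∀ i ∈ s, DifferentiableAt ℝ (F i) u) (a : Fin n) :
    pd (fun v => ∑ i ∈ s, F i v) a u = ∑ i ∈ s, pd (F i) a u := by
  simp [pd, fderiv_fun_sum hF]

lemma pd_const (c : ℝ) (a : Fin n) : pd (fun _ => c) a u = 0 := by simp [pd]

lemma pd_congr (h : f =ᶠ[nhds u] g) (a : Fin n) : pd f a u = pd g a u := by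
  simp [pd, h.fderiv_eq]

lemma fderiv_apply_eq_sum_pd (f : EuclideanSpace ℝ (Fin n) → ℝ) (u w : EuclideanSpace ℝ (Fin n)) :
    fderiv ℝ f u w = ∑ a, w a * pd f a u := by
  conv_lhs => rw [← (EuclideanSpace.basisFun (Fin n) ℝ).sum_repr w]
  simp [pd]

/-- The chain rule. -/
lemma pd_comp {F : EuclideanSpace ℝ (Fin m) → ℝ}
    {x : EuclideanSpace ℝ (Fin n) → EuclideanSpace ℝ (Fin m)}
    (hF : DifferentiableAt ℝ F (x u)) (hx : DifferentiableAt ℝ x u) (a : Fin n) :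
    pd (fun v => F (x v)) a u = ∑ q, pd (fun v => x v q) a u * pd F q (x u) := by
  have h1 : fderiv ℝ (fun v => F (x v)) u = (fderiv ℝ F (x u)).comp (fderiv ℝ x u) :=
    fderiv_comp u hF hx
  rw [pd, h1, ContinuousLinearMap.comp_apply, fderiv_apply_eq_sum_pd]
  refine Finset.sum_congr rfl fun q _ => ?_
  have h2 := ((EuclideanSpace.proj (𝕜 := ℝ) q).hasFDerivAt.comp u hx.hasFDerivAt).fderiv
  have h3 : pd (fun v => x v q) a u = fderiv ℝ x u (EuclideanSpace.single a 1) q := by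
    rw [pd]
    exact congrArg (fun L => L (EuclideanSpace.single a 1)) h2
  rw [h3]

lemma pd_comm (hf : ContDiffAt ℝ ∞ f u) (a b : Fin n) :
    pd (fun v => pd f a v) b u = pd (fun v => pd f b v) a u := by
  have hs : IsSymmSndFDerivAt ℝ f u := hf.isSymmSndFDerivAt (by
    rw [minSmoothness_of_isRCLikeNormedField]; exact WithTop.coe_le_coe.2 (le_top : (2 : ℕ∞) ≤ ⊤))
  have hd : DifferentiableAt ℝ (fderiv ℝ f) u :=
    (hf.fderiv_right (m := ∞) (by simp)).differentiableAt (by simp)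
  have key : ∀ c d : Fin n, pd (fun v => pd f c v) d u =
      fderiv ℝ (fderiv ℝ f) u (EuclideanSpace.single d 1) (EuclideanSpace.single c 1) := by
    intro c d
    simp only [pd]
    rw [fderiv_clm_apply hd (differentiableAt_const _)]
    simp
  rw [key, key, hs.eq]

lemma contDiffAt_pd (hf : ContDiffAt ℝ ∞ f u) (a : Fin n) :
    ContDiffAt ℝ ∞ (fun v => pd f a v) u :=
  (hf.fderiv_right (m := ∞) (by simp)).clm_apply contDiffAt_const

lemma diffAt (hf : ContDiffAt ℝ ∞ f u) : DifferentiableAt ℝ f u :=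
  hf.differentiableAt (by simp)

/-! ### Entrywise calculus of matrix-valued maps -/

variable {ι κ τ : Type*}

/-- The entrywise partial derivative of a matrix. -/
noncomputable def mpd (A : EuclideanSpace ℝ (Fin n) → Matrix ι κ ℝ) (a : Fin n)
    (u : EuclideanSpace ℝ (Fin n)) : Matrix ι κ ℝ :=
  Matrix.of fun i j => pd (fun v => A v i j) a u

/-- The matrix-valued map `A` has smooth entries at `u`. -/
def SmoothEntriesAt (A : EuclideanSpace ℝ (Fin n) → Matrix ι κ ℝ)
    (u : EuclideanSpace ℝ (Fin n)) : Prop :=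
  ∀ i j, ContDiffAt ℝ ∞ (fun v => A v i j) u

variable {A B : EuclideanSpace ℝ (Fin n) → Matrix ι κ ℝ}

lemma mpd_add (hA : SmoothEntriesAt A u) (hB : SmoothEntriesAt B u) (a : Fin n) :
    mpd (fun v => A v + B v) a u = mpd A a u + mpd B a u := by
  ext i j; exact pd_add (diffAt (hA i j)) (diffAt (hB i j)) a

lemma mpd_transpose (a : Fin n) : mpd (fun v => (A v)ᵀ) a u = (mpd A a u)ᵀ := rfl

lemma mpd_congr (h : A =ᶠ[nhds u] B) (a : Fin n) : mpd A a u = mpd B a u := by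
  ext i j; exact pd_congr (h.mono fun v hv => by simp [hv]) a

lemma mpd_mul [Fintype κ] {C : EuclideanSpace ℝ (Fin n) → Matrix κ τ ℝ}
    (hA : SmoothEntriesAt A u) (hC : SmoothEntriesAt C u) (a : Fin n) :
    mpd (fun v => A v * C v) a u = mpd A a u * C u + A u * mpd C a u := by
  ext i j
  have h : ∀ l ∈ (Finset.univ : Finset κ), DifferentiableAt ℝ (fun v => A v i l * C v l j) u :=
    fun l _ => (diffAt (hA i l)).mul (diffAt (hC l j))
  simp only [mpd, Matrix.of_apply, Matrix.mul_apply, Matrix.add_apply]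
  rw [pd_sum _ h, ← Finset.sum_add_distrib]
  exact Finset.sum_congr rfl fun l _ => pd_mul (diffAt (hA i l)) (diffAt (hC l j)) a

lemma mpd_comm (hA : SmoothEntriesAt A u) (a b : Fin n) :
    mpd (fun v => mpd A a v) b u = mpd (fun v => mpd A b v) a u := by
  ext i j; exact pd_comm (hA i j) a b

lemma SmoothEntriesAt.transpose (hA : SmoothEntriesAt A u) :
    SmoothEntriesAt (fun v => (A v)ᵀ) u := fun i j => hA j i

lemma SmoothEntriesAt.mul [Fintype κ] {C : EuclideanSpace ℝ (Fin n) → Matrix κ τ ℝ}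
    (hA : SmoothEntriesAt A u) (hC : SmoothEntriesAt C u) :
    SmoothEntriesAt (fun v => A v * C v) u := fun i j => by
  simp only [Matrix.mul_apply]
  exact ContDiffAt.sum fun l _ => (hA i l).mul (hC l j)

lemma SmoothEntriesAt.det [Fintype ι] [DecidableEq ι]
    {A : EuclideanSpace ℝ (Fin n) → Matrix ι ι ℝ} (hA : SmoothEntriesAt A u) :
    ContDiffAt ℝ ∞ (fun v => (A v).det) u := by
  simp only [Matrix.det_apply']
  exact ContDiffAt.sum fun σ _ => contDiffAt_const.mul (contDiffAt_prod fun i _ => hA _ _)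

/-- By Cramer's rule the entries are cofactors over the determinant, and a cofactor is the
determinant of the matrix with one row replaced by a constant one. -/
lemma SmoothEntriesAt.inv [Fintype ι] [DecidableEq ι]
    {A : EuclideanSpace ℝ (Fin n) → Matrix ι ι ℝ} (hA : SmoothEntriesAt A u)
    (h : (A u).det ≠ 0) : SmoothEntriesAt (fun v => (A v)⁻¹) u := by
  intro i j
  simp only [Matrix.inv_def, Ring.inverse_eq_inv', Matrix.smul_apply, smul_eq_mul,
    Matrix.adjugate_apply]
  refine (hA.det.inv h).mul (SmoothEntriesAt.det fun k l => ?_)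
  by_cases hk : k = j
  · subst hk; simpa using contDiffAt_const
  · simpa [Matrix.updateRow_ne hk] using hA k l

end Calculus

/-! ### Pairings -/

section Pairing

variable {n : ℕ} {G : Matrix (Fin n) (Fin n) ℝ}

lemma pairing_eq_dotProduct (G : Matrix (Fin n) (Fin n) ℝ) (V W : Fin n → ℝ) :
    pairing G V W = V ⬝ᵥ G *ᵥ W := by
  simp only [pairing, dotProduct, mulVec, Finset.mul_sum]
  exact Finset.sum_congr rfl fun i _ => Finset.sum_congr rfl fun j _ => by ring

lemma pairing_comm (hG : G.IsSymm) (V W : Fin n → ℝ) : pairing G V W = pairing G W V := by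
  rw [pairing_eq_dotProduct, pairing_eq_dotProduct, dotProduct_mulVec, ← mulVec_transpose, hG.eq,
    dotProduct_comm]

lemma pairing_add_left (V V' W : Fin n → ℝ) :
    pairing G (V + V') W = pairing G V W + pairing G V' W := by
  simp [pairing_eq_dotProduct]

lemma pairing_add_right (V W W' : Fin n → ℝ) :
    pairing G V (W + W') = pairing G V W + pairing G V W' := by
  simp [pairing_eq_dotProduct, mulVec_add]

lemma pairing_smul_left (c : ℝ) (V W : Fin n → ℝ) :
    pairing G (c • V) W = c * pairing G V W := by
  simp [pairing_eq_dotProduct]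

lemma pairing_smul_right (c : ℝ) (V W : Fin n → ℝ) :
    pairing G V (c • W) = c * pairing G V W := by
  simp [pairing_eq_dotProduct, mulVec_smul]

/-- The pairing as a bilinear map. -/
def pairingₗ (G : Matrix (Fin n) (Fin n) ℝ) : (Fin n → ℝ) →ₗ[ℝ] (Fin n → ℝ) →ₗ[ℝ] ℝ :=
  LinearMap.mk₂ ℝ (pairing G) pairing_add_left pairing_smul_left pairing_add_right
    pairing_smul_right

@[simp] lemma pairingₗ_apply (V W : Fin n → ℝ) : pairingₗ G V W = pairing G V W := rfl

lemma pairing_neg_left (V W : Fin n → ℝ) : pairing G (-V) W = -pairing G V W := by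
  simp [← pairingₗ_apply]

lemma pairing_sub_left (V V' W : Fin n → ℝ) :
    pairing G (V - V') W = pairing G V W - pairing G V' W := by
  simp [← pairingₗ_apply]

lemma pairing_sum_left {ι : Type*} (s : Finset ι) (V : ι → Fin n → ℝ) (W : Fin n → ℝ) :
    pairing G (∑ i ∈ s, V i) W = ∑ i ∈ s, pairing G (V i) W := by
  simp [← pairingₗ_apply]

lemma pairing_sum_right {ι : Type*} (s : Finset ι) (V : Fin n → ℝ) (W : ι → Fin n → ℝ) :
    pairing G V (∑ i ∈ s, W i) = ∑ i ∈ s, pairing G V (W i) := by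
  simp [← pairingₗ_apply]

lemma pairing_zero_left (W : Fin n → ℝ) : pairing G 0 W = 0 := by
  simp [← pairingₗ_apply]

lemma pairing_mulVec_left (A : Matrix (Fin n) (Fin n) ℝ) (V W : Fin n → ℝ) :
    pairing G (A *ᵥ V) W = pairing (Aᵀ * G) V W := by
  rw [pairing_eq_dotProduct, pairing_eq_dotProduct, dotProduct_comm, dotProduct_mulVec,
    ← mulVec_transpose, dotProduct_comm, mulVec_mulVec]

lemma pairing_mulVec_right (A : Matrix (Fin n) (Fin n) ℝ) (V W : Fin n → ℝ) :
    pairing G V (A *ᵥ W) = pairing (G * A) V W := by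
  rw [pairing_eq_dotProduct, pairing_eq_dotProduct, mulVec_mulVec]

lemma pairing_add_mat (G G' : Matrix (Fin n) (Fin n) ℝ) (V W : Fin n → ℝ) :
    pairing (G + G') V W = pairing G V W + pairing G' V W := by
  simp [pairing_eq_dotProduct, add_mulVec]

end Pairing

/-! ### The Levi-Civita connection in coordinates -/

/-- `G` is a smooth Riemannian metric on the open set `O`. -/
structure IsMetricOn {m : ℕ} (G : EuclideanSpace ℝ (Fin m) → Matrix (Fin m) (Fin m) ℝ)
    (O : Set (EuclideanSpace ℝ (Fin m))) : Prop where
  isOpen : IsOpen O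
  smooth : ∀ y ∈ O, SmoothEntriesAt G y
  symm : ∀ y ∈ O, (G y).IsSymm
  pos : ∀ y ∈ O, ∀ V, V ≠ 0 → 0 < pairing (G y) V V

/-- The matrix `(Γ_k)^i_j = Γ^i_kj`. -/
noncomputable def christoffelMatrix {m : ℕ}
    (G : EuclideanSpace ℝ (Fin m) → Matrix (Fin m) (Fin m) ℝ)
    (k : Fin m) (y : EuclideanSpace ℝ (Fin m)) : Matrix (Fin m) (Fin m) ℝ :=
  Matrix.of fun i j => christoffel G y i k j

/-- The matrix `(R_kl)^i_j = R^i_jkl`. -/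
noncomputable def riemannMatrix {m : ℕ}
    (G : EuclideanSpace ℝ (Fin m) → Matrix (Fin m) (Fin m) ℝ)
    (k l : Fin m) (y : EuclideanSpace ℝ (Fin m)) : Matrix (Fin m) (Fin m) ℝ :=
  Matrix.of fun i j => riemann G y i j k l

lemma riemannMatrix_eq {m : ℕ} (G : EuclideanSpace ℝ (Fin m) → Matrix (Fin m) (Fin m) ℝ)
    (k l : Fin m) (y : EuclideanSpace ℝ (Fin m)) :
    riemannMatrix G k l y = mpd (christoffelMatrix G l) k y - mpd (christoffelMatrix G k) l y
      + (christoffelMatrix G k y * christoffelMatrix G l y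
        - christoffelMatrix G l y * christoffelMatrix G k y) := by
  ext i j
  simp [riemannMatrix, riemann, mpd, christoffelMatrix, Matrix.mul_apply,
    Finset.sum_sub_distrib]

namespace IsMetricOn

variable {m : ℕ} {G : EuclideanSpace ℝ (Fin m) → Matrix (Fin m) (Fin m) ℝ}
  {O : Set (EuclideanSpace ℝ (Fin m))} (hG : IsMetricOn G O) {y : EuclideanSpace ℝ (Fin m)}

include hG

lemma det_pos (hy : y ∈ O) : 0 < (G y).det := by
  refine Matrix.PosDef.det_pos (Matrix.posDef_iff_dotProduct_mulVec.2 ⟨?_, fun V hV => ?_⟩)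
  · rw [Matrix.IsHermitian, Matrix.conjTranspose_eq_transpose_of_trivial]; exact hG.symm y hy
  · simpa [pairing_eq_dotProduct] using hG.pos y hy V hV

lemma mul_inv (hy : y ∈ O) : G y * (G y)⁻¹ = 1 :=
  Matrix.mul_nonsing_inv _ (isUnit_iff_ne_zero.2 (hG.det_pos hy).ne')

lemma inv_mul (hy : y ∈ O) : (G y)⁻¹ * G y = 1 :=
  Matrix.nonsing_inv_mul _ (isUnit_iff_ne_zero.2 (hG.det_pos hy).ne')

lemma pd_symm (hy : y ∈ O) (i j k : Fin m) :
    pd (fun z => G z i j) k y = pd (fun z => G z j i) k y :=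
  pd_congr ((hG.isOpen.eventually_mem hy).mono fun z hz => (hG.symm z hz).apply j i) k

lemma christoffel_symm (hy : y ∈ O) (i j k : Fin m) :
    christoffel G y i j k = christoffel G y i k j := by
  unfold christoffel
  congr 1
  refine Finset.sum_congr rfl fun l _ => ?_
  rw [hG.pd_symm hy j k l]; ring

/-- The Christoffel symbols of the first kind. -/
lemma sum_mul_christoffel (hy : y ∈ O) (l j k : Fin m) :
    ∑ i, G y l i * christoffel G y i j k = (1 / 2) * (pd (fun z => G z l k) j y
      + pd (fun z => G z l j) k y - pd (fun z => G z j k) l y) := by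
  set F : Fin m → ℝ := fun l => pd (fun z => G z l k) j y
      + pd (fun z => G z l j) k y - pd (fun z => G z j k) l y with hF
  have h : (fun i => christoffel G y i j k) = (1 / 2 : ℝ) • ((G y)⁻¹ *ᵥ F) := by
    ext i; simp [christoffel, mulVec, dotProduct, hF]
  change (G y *ᵥ fun i => christoffel G y i j k) l = _
  rw [h, mulVec_smul, mulVec_mulVec, hG.mul_inv hy, one_mulVec]
  simp [hF]

lemma smooth_christoffel (hy : y ∈ O) (i j k : Fin m) :
    ContDiffAt ℝ ∞ (fun z => christoffel G z i j k) y := by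
  unfold christoffel
  have h := fun a b c => contDiffAt_pd (hG.smooth y hy a b) c
  exact contDiffAt_const.mul (ContDiffAt.sum fun l _ =>
    ((hG.smooth y hy).inv (hG.det_pos hy).ne' i l).mul (((h _ _ _).add (h _ _ _)).sub (h _ _ _)))

lemma smooth_christoffelMatrix (hy : y ∈ O) (k : Fin m) :
    SmoothEntriesAt (christoffelMatrix G k) y := fun i j => hG.smooth_christoffel hy i k j

/-- The metric is parallel. -/
lemma mpd_metric (hy : y ∈ O) (k : Fin m) :
    mpd G k y = (christoffelMatrix G k y)ᵀ * G y + G y * christoffelMatrix G k y := by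
  ext i j
  have h1 := hG.sum_mul_christoffel hy i k j
  have h2 := hG.sum_mul_christoffel hy j k i
  have h3 : ∀ q, G y j q * christoffel G y q k i = christoffel G y q k i * G y q j := fun q => by
    rw [(hG.symm y hy).apply q j]; ring
  simp only [mpd, christoffelMatrix, Matrix.of_apply, Matrix.add_apply, Matrix.mul_apply,
    Matrix.transpose_apply, ← h3]
  -- In the sum of the two symbols of the first kind, four of the six derivatives cancel and the
  -- other two add up to `∂_k g_ij`.
  rw [h1, h2, hG.pd_symm hy i k j, hG.pd_symm hy j k i, hG.pd_symm hy j i k]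
  ring

/-- The curvature operators are skew-adjoint. -/
lemma riemannMatrix_skew (hy : y ∈ O) (k l : Fin m) :
    (riemannMatrix G k l y)ᵀ * G y + G y * riemannMatrix G k l y = 0 := by
  have hd : ∀ k l, mpd (fun z => mpd G k z) l y =
      (mpd (christoffelMatrix G k) l y)ᵀ * G y + (christoffelMatrix G k y)ᵀ *
        ((christoffelMatrix G l y)ᵀ * G y + G y * christoffelMatrix G l y)
      + (((christoffelMatrix G l y)ᵀ * G y + G y * christoffelMatrix G l y)
        * christoffelMatrix G k y + G y * mpd (christoffelMatrix G k) l y) := by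
    intro k l
    have hs := hG.smooth_christoffelMatrix hy k
    rw [mpd_congr ((hG.isOpen.eventually_mem hy).mono fun z hz => hG.mpd_metric hz k) l,
      mpd_add (hs.transpose.mul (hG.smooth y hy)) ((hG.smooth y hy).mul hs),
      mpd_mul hs.transpose (hG.smooth y hy), mpd_mul (hG.smooth y hy) hs, mpd_transpose,
      hG.mpd_metric hy]
  -- With parallelism substituted twice, symmetry of the second derivatives of the metric is the
  -- claim: the mixed terms `Γ_kᵀ G Γ_l + Γ_lᵀ G Γ_k` drop out.
  have hc := mpd_comm (hG.smooth y hy) l k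
  rw [hd, hd] at hc
  rw [riemannMatrix_eq]
  simp only [transpose_add, transpose_sub, transpose_mul]
  rw [← sub_eq_zero] at hc
  rw [← hc]
  noncomm_ring

end IsMetricOn

/-! ### The curvature tensor -/

section Curvature

variable {m : ℕ} {G : EuclideanSpace ℝ (Fin m) → Matrix (Fin m) (Fin m) ℝ}
  {O : Set (EuclideanSpace ℝ (Fin m))} {y : EuclideanSpace ℝ (Fin m)}

lemma curvature_eq_sum (G : EuclideanSpace ℝ (Fin m) → Matrix (Fin m) (Fin m) ℝ)
    (y : EuclideanSpace ℝ (Fin m)) (X Y Z : Fin m → ℝ) :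
    curvature G y X Y Z = ∑ k, ∑ l, (X k * Y l) • (riemannMatrix G k l y *ᵥ Z) := by
  ext i
  simp only [curvature, riemannMatrix, Finset.sum_apply, Pi.smul_apply, smul_eq_mul, mulVec,
    dotProduct, Matrix.of_apply, Finset.mul_sum]
  rw [Finset.sum_comm]
  refine Finset.sum_congr rfl fun k _ => ?_
  rw [Finset.sum_comm]
  exact Finset.sum_congr rfl fun l _ => Finset.sum_congr rfl fun j _ => by ring

/-- The curvature tensor `⟨R(X, Y) Z, W⟩` as a multilinear map. -/
noncomputable def curvatureₗ (G : EuclideanSpace ℝ (Fin m) → Matrix (Fin m) (Fin m) ℝ)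
    (y : EuclideanSpace ℝ (Fin m)) :
    (Fin m → ℝ) →ₗ[ℝ] (Fin m → ℝ) →ₗ[ℝ] (Fin m → ℝ) →ₗ[ℝ] (Fin m → ℝ) →ₗ[ℝ] ℝ :=
  ∑ k, ∑ l, (LinearMap.proj k : (Fin m → ℝ) →ₗ[ℝ] ℝ).smulRight
    ((LinearMap.proj l : (Fin m → ℝ) →ₗ[ℝ] ℝ).smulRight
      (pairingₗ (G y) ∘ₗ (riemannMatrix G k l y).mulVecLin))

lemma curvatureₗ_apply (X Y Z W : Fin m → ℝ) :
    curvatureₗ G y X Y Z W = pairing (G y) (curvature G y X Y Z) W := by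
  simp only [curvature_eq_sum, pairing_sum_left, pairing_smul_left, curvatureₗ,
    LinearMap.sum_apply, LinearMap.smulRight_apply, LinearMap.smul_apply, LinearMap.comp_apply,
    LinearMap.proj_apply, pairingₗ_apply, Matrix.mulVecLin_apply, smul_eq_mul, mul_assoc]

lemma riemann_swap (i j k l : Fin m) : riemann G y i j k l = -riemann G y i j l k := by
  simp only [riemann, Finset.sum_sub_distrib]; ring

lemma curvature_swap (X Y Z : Fin m → ℝ) : curvature G y X Y Z = -curvature G y Y X Z := by
  ext i
  simp only [curvature, Pi.neg_apply, ← Finset.sum_neg_distrib]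
  refine Finset.sum_congr rfl fun j _ => ?_
  rw [Finset.sum_comm]
  exact Finset.sum_congr rfl fun l _ => Finset.sum_congr rfl fun k _ => by
    rw [riemann_swap]; ring

/-- Skew-symmetry in the last two arguments. -/
lemma IsMetricOn.curvature_skew (hG : IsMetricOn G O) (hy : y ∈ O) (X Y Z W : Fin m → ℝ) :
    pairing (G y) (curvature G y X Y Z) W = -pairing (G y) (curvature G y X Y W) Z := by
  simp only [curvature_eq_sum, pairing_sum_left, pairing_smul_left, ← Finset.sum_neg_distrib]
  refine Finset.sum_congr rfl fun k _ => Finset.sum_congr rfl fun l _ => ?_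
  have h := congrArg (fun A => pairing A Z W) (hG.riemannMatrix_skew hy k l)
  simp only [pairing_add_mat] at h
  rw [← pairing_mulVec_left, ← pairing_mulVec_right] at h
  have h0 : pairing (0 : Matrix (Fin m) (Fin m) ℝ) Z W = 0 := by simp [pairing]
  rw [h0, pairing_comm (hG.symm y hy) Z] at h
  linear_combination X k * Y l * h

lemma sum_rotate {ι : Type*} [Fintype ι] (F : ι → ι → ι → ℝ) :
    ∑ j, ∑ k, ∑ l, F j k l = ∑ j, ∑ k, ∑ l, F k l j := by
  rw [Finset.sum_comm]
  conv_rhs => rw [Finset.sum_comm]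
  rw [Finset.sum_comm]
  exact Finset.sum_congr rfl fun j _ => Finset.sum_comm

/-- The first Bianchi identity. -/
lemma IsMetricOn.bianchi (hG : IsMetricOn G O) (hy : y ∈ O) (X Y Z : Fin m → ℝ) :
    curvature G y X Y Z + curvature G y Y Z X + curvature G y Z X Y = 0 := by
  have hs : ∀ i j k l, pd (fun z => christoffel G z i k j) l y =
      pd (fun z => christoffel G z i j k) l y := fun i j k l =>
    pd_congr ((hG.isOpen.eventually_mem hy).mono fun z hz => hG.christoffel_symm hz i k j) l
  -- By the symmetry of the lower indices of `Γ`, both the derivative terms and the quadratic terms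
  -- cancel in pairs.
  have h : ∀ i j k l, riemann G y i j k l + riemann G y i l j k + riemann G y i k l j = 0 := by
    intro i j k l
    simp only [riemann, Finset.sum_sub_distrib]
    rw [hs i j l k, hs i j k l, hs i l k j]
    have e : ∀ a b c, ∑ q, christoffel G y i a q * christoffel G y q b c =
        ∑ q, christoffel G y i a q * christoffel G y q c b := fun a b c =>
      Finset.sum_congr rfl fun q _ => by rw [hG.christoffel_symm hy q b c]
    rw [e k l j, e l k j, e j k l]
    ring
  ext i
  simp only [curvature, Pi.add_apply, Pi.zero_apply]
  -- The second sum is rotated once and the third twice, so that all three carry the common factor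
  -- `X k * Y l * Z j`.
  rw [sum_rotate fun j k l => riemann G y i j k l * Y k * Z l * X j,
    sum_rotate fun j k l => riemann G y i j k l * Z k * X l * Y j,
    sum_rotate fun j k l => riemann G y i k l j * Z l * X j * Y k]
  simp only [← Finset.sum_add_distrib]
  refine Finset.sum_eq_zero fun j _ => Finset.sum_eq_zero fun k _ => Finset.sum_eq_zero fun l _ => ?_
  linear_combination X k * Y l * Z j * h i j k l

end Curvature

/-- An algebraic curvature tensor with vanishing sectional curvatures is zero. -/
lemma curvatureTensor_eq_zero {V : Type*} [AddCommGroup V] (T : V → V → V → V → ℝ)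
    (h1 : ∀ X X' Y Z W, T (X + X') Y Z W = T X Y Z W + T X' Y Z W)
    (h3 : ∀ X Y Z Z' W, T X Y (Z + Z') W = T X Y Z W + T X Y Z' W)
    (s12 : ∀ X Y Z W, T X Y Z W = -T Y X Z W) (s34 : ∀ X Y Z W, T X Y Z W = -T X Y W Z)
    (b : ∀ X Y Z W, T X Y Z W + T Y Z X W + T Z X Y W = 0) (h : ∀ X Y, T X Y Y X = 0)
    (X Y Z W : V) : T X Y Z W = 0 := by
  -- Pair symmetry: the Bianchi identities of the four cyclic rotations of the arguments, combined
  -- modulo the two skew symmetries.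
  have hp : ∀ X Y Z W, T X Y Z W = T Z W X Y := fun X Y Z W => by
    linarith [b X Y Z W, b Y Z W X, b Z W X Y, b W X Y Z, s12 X Y Z W, s34 X Y Z W,
      s12 Y Z X W, s34 Y Z X W, s34 Y Z W X, s12 Z X Y W, s34 Z X Y W, s12 Z W X Y, s34 Z W X Y,
      s12 W Y Z X, s34 W Y Z X, s12 W X Y Z, s34 W X Y Z, s12 X Z Y W, s34 X Z Y W, s12 Y W X Z,
      s34 Y W X Z, s34 Z W Y X, s12 X Z W Y, s34 X Z W Y, s12 Z Y W X, s12 X W Y Z, s34 X Y W Z,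
      s12 W Z X Y, s12 Y X Z W, s34 Y X Z W, s12 Y W Z X, s34 W Z X Y, s34 X W Y Z]
  have h2 : ∀ X Y Y' Z W, T X (Y + Y') Z W = T X Y Z W + T X Y' Z W := fun X Y Y' Z W => by
    rw [s12, h1, s12 Y, s12 Y']; ring
  have h4 : ∀ X Y Z W W', T X Y Z (W + W') = T X Y Z W + T X Y Z W' := fun X Y Z W W' => by
    rw [s34, h3, s34 X Y W, s34 X Y W']; ring
  -- Polarization of `h` in the inner pair, then in `k2` in the outer pair. The resulting skewness
  -- in the first and last slots makes `T` invariant under rotation of its first three arguments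
  -- (`k3`), so Bianchi reads `3 T = 0`.
  have k1 : ∀ X Y Z, T X Y Z X = 0 := fun X Y Z => by
    have e := h X (Y + Z)
    rw [h2, h3, h3, h, h, hp X Z Y X, s12 Y, s34 X Y X Z] at e
    linarith
  have k2 : ∀ X Y Z W, T X Y Z W = -T W Y Z X := fun X Y Z W => by
    have e := k1 (X + W) Y Z
    rw [h1, h4, h4, k1, k1] at e
    linarith
  have k3 : ∀ X Y Z, T Y Z X W = T X Y Z W := fun X Y Z => by
    linarith [s12 Y Z X W, s34 Z Y X W, k2 Z Y W X, s34 X Y W Z]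
  linarith [b X Y Z W, k3 X Y Z, k3 Y Z X]

variable {m : ℕ} {G : EuclideanSpace ℝ (Fin m) → Matrix (Fin m) (Fin m) ℝ}
  {O : Set (EuclideanSpace ℝ (Fin m))} {y : EuclideanSpace ℝ (Fin m)}

/-- The curvature tensor of a metric with constant sectional curvatures. -/
lemma IsMetricOn.curvature_of_const (hG : IsMetricOn G O) (hy : y ∈ O) {K : ℝ}
    (hK : ∀ X Y, pairing (G y) (curvature G y X Y Y) X
      = K * (pairing (G y) X X * pairing (G y) Y Y - pairing (G y) X Y ^ 2))
    (X Y Z W : Fin m → ℝ) :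
    pairing (G y) (curvature G y X Y Z) W =
      K * (pairing (G y) Y Z * pairing (G y) X W - pairing (G y) X Z * pairing (G y) Y W) := by
  have hc := pairing_comm (hG.symm y hy)
  -- The difference from the model tensor is again an algebraic curvature tensor, and its sectional
  -- curvatures vanish by `hK`.
  refine sub_eq_zero.1 (curvatureTensor_eq_zero
    (fun X Y Z W => pairing (G y) (curvature G y X Y Z) W - K * (pairing (G y) Y Z *
      pairing (G y) X W - pairing (G y) X Z * pairing (G y) Y W)) ?_ ?_ ?_ ?_ ?_ ?_ X Y Z W)
  · intro X X' Y Z W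
    simp only [← curvatureₗ_apply, map_add, LinearMap.add_apply, pairing_add_left]; ring
  · intro X Y Z Z' W
    simp only [← curvatureₗ_apply, map_add, LinearMap.add_apply, pairing_add_right]; ring
  · intro X Y Z W
    rw [curvature_swap, pairing_neg_left]; ring
  · intro X Y Z W
    rw [hG.curvature_skew hy]; ring
  · intro X Y Z W
    have := congrArg (fun V => pairing (G y) V W) (hG.bianchi hy X Y Z)
    simp only [pairing_add_left, pairing_zero_left] at this
    rw [hc Z Y, hc Z X, hc Y X]
    linear_combination this
  · intro X Y
    rw [hK, hc Y X]; ring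

/-! ### Sums over permutations -/

/-- Each value `a` of `σ 0` is taken by `n!` permutations. -/
lemma sum_perm_apply_zero {n : ℕ} (F : Fin (n + 1) → ℝ) :
    ∑ σ : Equiv.Perm (Fin (n + 1)), F (σ 0) = n.factorial * ∑ a, F a := by
  rw [← Equiv.Perm.decomposeFin.symm.sum_comp, Fintype.sum_prod_type, Finset.mul_sum]
  simp [Fintype.card_perm]

/-- Both sides are the determinant of `g` with row `a` replaced by `w`, once by the Leibniz formula
and once by Cramer's rule. -/
lemma sum_perm_sign_mul_row {n : ℕ} (g : Matrix (Fin n) (Fin n) ℝ) (w : Fin n → ℝ) (a : Fin n) :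
    ∑ π : Equiv.Perm (Fin n), ((Equiv.Perm.sign π : ℤ) : ℝ) * (w (π a) *
      ∏ b ∈ Finset.univ.erase a, g b (π b)) = ∑ b, w b * g.adjugate b a := by
  have h : (g.updateRow a w).det = ∑ b, w b * g.adjugate b a := by
    rw [← Matrix.det_transpose, ← Matrix.updateCol_transpose, ← Matrix.cramer_apply,
      Matrix.cramer_eq_adjugate_mulVec, ← Matrix.adjugate_transpose]
    simp only [Matrix.mulVec, dotProduct, Matrix.transpose_apply]
    exact Finset.sum_congr rfl fun b _ => mul_comm _ _
  rw [← h, ← Matrix.det_transpose, Matrix.det_apply']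
  refine Finset.sum_congr rfl fun π _ => ?_
  rw [← Finset.mul_prod_erase _ _ (Finset.mem_univ a)]
  congr 2
  · simp
  · exact Finset.prod_congr rfl fun b hb => by simp [Finset.ne_of_mem_erase hb]

/-- The expansion of the contraction of two generalized Kronecker symbols. -/
lemma sum_perm_sum_perm {n : ℕ} (g : Matrix (Fin (n + 1)) (Fin (n + 1)) ℝ)
    (v w : Fin (n + 1) → ℝ) :
    ∑ σ : Equiv.Perm (Fin (n + 1)), ∑ τ : Equiv.Perm (Fin (n + 1)),
      ((Equiv.Perm.sign σ : ℤ) : ℝ) * ((Equiv.Perm.sign τ : ℤ) : ℝ) * (v (σ 0) * w (τ 0) *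
        ∏ t : Fin n, g (σ t.succ) (τ t.succ))
      = n.factorial * ∑ a, ∑ b, v a * w b * g.adjugate b a := by
  have h : ∀ σ : Equiv.Perm (Fin (n + 1)), ∑ τ : Equiv.Perm (Fin (n + 1)),
      ((Equiv.Perm.sign σ : ℤ) : ℝ) * ((Equiv.Perm.sign τ : ℤ) : ℝ) * (v (σ 0) * w (τ 0) *
        ∏ t : Fin n, g (σ t.succ) (τ t.succ)) = v (σ 0) * ∑ b, w b * g.adjugate b (σ 0) := by
    intro σ
    -- The substitution `τ = π * σ` leaves only the sign of `π`, since the sign of `σ` is squared.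
    -- The product then runs over the rows `b = σ t.succ`, which are all rows but `σ 0`.
    rw [← sum_perm_sign_mul_row, Finset.mul_sum, ← Equiv.sum_comp (Equiv.mulRight σ)]
    refine Finset.sum_congr rfl fun π _ => ?_
    have hs : ((Equiv.Perm.sign σ : ℤ) : ℝ) * ((Equiv.Perm.sign σ : ℤ) : ℝ) = 1 := by
      rw [← Int.cast_mul, ← Units.val_mul, Int.units_mul_self]; simp
    have hp : ∏ b ∈ Finset.univ.erase (σ 0), g b (π b) =
        ∏ t : Fin n, g (σ t.succ) (π (σ t.succ)) := by
      refine (Finset.prod_bij (fun t _ => σ t.succ) (fun t _ => ?_) (fun t _ t' _ h => ?_)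
        (fun b hb => ?_) fun t _ => rfl).symm
      · simp [Fin.succ_ne_zero]
      · simpa using h
      · have hb' : σ.symm b ≠ 0 := fun h => Finset.ne_of_mem_erase hb (by simp [← h])
        obtain ⟨t, ht⟩ := Fin.exists_succ_eq.2 hb'
        exact ⟨t, Finset.mem_univ _, by simp [ht]⟩
    rw [hp]
    simp only [Equiv.coe_mulRight, Equiv.Perm.sign_mul, Equiv.Perm.mul_apply, Units.val_mul,
      Int.cast_mul]
    linear_combination (((Equiv.Perm.sign π : ℤ) : ℝ) * (v (σ 0) * w (π (σ 0)) *
        ∏ t : Fin n, g (σ t.succ) (π (σ t.succ)))) * hs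
  rw [Finset.sum_congr rfl fun σ _ => h σ,
    sum_perm_apply_zero fun a => v a * ∑ b, w b * g.adjugate b a]
  simp only [Finset.mul_sum, mul_assoc]

lemma sum_sum_prod_eq {n m : ℕ} (F : Fin n → Fin m → Fin m → ℝ) :
    ∑ I : Fin n → Fin m, ∑ J : Fin n → Fin m, ∏ t, F t (I t) (J t) = ∏ t, ∑ i, ∑ j, F t i j := by
  rw [Finset.prod_univ_sum]
  simp only [Fintype.piFinset_univ]
  refine Finset.sum_congr rfl fun I _ => ?_
  rw [Finset.prod_univ_sum]
  simp only [Fintype.piFinset_univ]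

/-! ### Contraction of the ε-symbol with a matrix and one-forms -/

section Antisymmetrization

variable {k : ℕ}

lemma succ_succ_ne_one (l : Fin k) : l.succ.succ ≠ (1 : Fin (k + 2)) := by
  rw [← Fin.succ_zero_eq_one]; exact fun h => Fin.succ_ne_zero _ (Fin.succ_injective _ h)

lemma swap_apply_succ_succ (l : Fin k) :
    Equiv.swap (0 : Fin (k + 2)) 1 l.succ.succ = l.succ.succ :=
  Equiv.swap_apply_of_ne_of_ne (Fin.succ_ne_zero _) (succ_succ_ne_one l)

/-- Precomposing with the transposition of `0` and `1` flips the sign and leaves the slots of `F`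
alone. -/
lemma sum_perm_swap (y : Fin (k + 2) → Fin (k + 2) → ℝ) (F : Fin k → Fin (k + 2) → ℝ) :
    ∑ σ : Equiv.Perm (Fin (k + 2)), ((Equiv.Perm.sign σ : ℤ) : ℝ) * y (σ 0) (σ 1) *
      ∏ l : Fin k, F l (σ l.succ.succ) =
    -∑ σ : Equiv.Perm (Fin (k + 2)), ((Equiv.Perm.sign σ : ℤ) : ℝ) * y (σ 1) (σ 0) *
      ∏ l : Fin k, F l (σ l.succ.succ) := by
  rw [← Equiv.sum_comp (Equiv.mulRight (Equiv.swap (0 : Fin (k + 2)) 1)), ← Finset.sum_neg_distrib]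
  refine Finset.sum_congr rfl fun σ _ => ?_
  simp [swap_apply_succ_succ]

lemma sum_perm_antisymm (y : Fin (k + 2) → Fin (k + 2) → ℝ) (F : Fin k → Fin (k + 2) → ℝ) :
    ∑ σ : Equiv.Perm (Fin (k + 2)), ((Equiv.Perm.sign σ : ℤ) : ℝ) * y (σ 0) (σ 1) *
      ∏ l : Fin k, F l (σ l.succ.succ) =
    (1 / 2) * ∑ σ : Equiv.Perm (Fin (k + 2)), ((Equiv.Perm.sign σ : ℤ) : ℝ) *
      (y (σ 0) (σ 1) - y (σ 1) (σ 0)) * ∏ l : Fin k, F l (σ l.succ.succ) := by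
  have h := sum_perm_swap y F
  simp only [mul_sub, sub_mul, Finset.sum_sub_distrib]
  linarith

lemma fin_cases_zero_one (j : Fin (k + 2)) : j = 0 ∨ j = 1 ∨ ∃ l : Fin k, j = l.succ.succ := by
  refine Fin.cases (Or.inl rfl) (fun j => Or.inr (Fin.cases (Or.inl rfl) (fun l => ?_) j)) j
  exact Or.inr ⟨l, rfl⟩

lemma eq_one_or_swap (π : Equiv.Perm (Fin (k + 2)))
    (h : ∀ l : Fin k, π l.succ.succ = l.succ.succ) : π = 1 ∨ π = Equiv.swap 0 1 := by
  have h0 : ∀ i : Fin (k + 2), i = 0 ∨ i = 1 → π i = 0 ∨ π i = 1 := by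
    intro i hi
    rcases fin_cases_zero_one (π i) with e | e | ⟨l, e⟩
    · exact Or.inl e
    · exact Or.inr e
    · rw [← h l] at e
      rw [π.injective e] at hi
      exact hi.elim (fun e => absurd e (Fin.succ_ne_zero _)) fun e => absurd e (succ_succ_ne_one l)
  have h01 : π 0 ≠ π 1 := fun e => zero_ne_one (π.injective e)
  rcases h0 0 (Or.inl rfl) with e | e <;> rcases h0 1 (Or.inr rfl) with e' | e'
  · exact absurd (e.trans e'.symm) h01
  · left
    ext i : 1
    rcases fin_cases_zero_one i with rfl | rfl | ⟨l, rfl⟩ <;> simp [*]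
  · right
    ext i : 1
    rcases fin_cases_zero_one i with rfl | rfl | ⟨l, rfl⟩
    · simp [e]
    · simp [e']
    · rw [h, swap_apply_succ_succ]
  · exact absurd (e.trans e'.symm) h01

/-- A skew-symmetric matrix whose contractions with decomposable forms vanish is zero. -/
lemma eq_zero_of_sum_perm_eq_zero (y : Fin (k + 2) → Fin (k + 2) → ℝ)
    (hy : ∀ a b, y a b = -y b a)
    (h : ∀ c : Fin k → Fin (k + 2), ∑ σ : Equiv.Perm (Fin (k + 2)),
      ((Equiv.Perm.sign σ : ℤ) : ℝ) * y (σ 0) (σ 1) *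
        ∏ l : Fin k, (if σ l.succ.succ = c l then 1 else 0) = 0) (a b : Fin (k + 2)) :
    y a b = 0 := by
  by_cases hab : a = b
  · subst hab; linarith [hy a a]
  obtain ⟨τ, h0, h1⟩ : ∃ τ : Equiv.Perm (Fin (k + 2)), τ 0 = a ∧ τ 1 = b := by
    -- The first swap sends `0` to `a`; the second sends the image of `1` to `b` and fixes `a`.
    refine ⟨Equiv.swap (Equiv.swap 0 a 1) b * Equiv.swap 0 a, ?_, ?_⟩
    · rw [Equiv.Perm.mul_apply, Equiv.swap_apply_left, Equiv.swap_apply_of_ne_of_ne _ hab]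
      intro e
      have e' : Equiv.swap 0 a 0 = Equiv.swap 0 a 1 := by rwa [Equiv.swap_apply_left]
      exact zero_ne_one ((Equiv.swap 0 a).injective e')
    · rw [Equiv.Perm.mul_apply, Equiv.swap_apply_left]
  -- This choice of `c` kills every permutation that differs from `τ` in a slot beyond the first
  -- two. Only `τ` and `τ * swap 0 1` survive, and by skewness they contribute equally.
  have h2 := h fun l => τ l.succ.succ
  rw [Fintype.sum_eq_add τ (τ * Equiv.swap 0 1)] at h2
  · have hs : ((Equiv.Perm.sign τ : ℤ) : ℝ) ≠ 0 := by simp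
    simp only [Equiv.Perm.sign_mul, Equiv.Perm.mul_apply, Equiv.swap_apply_left,
      Equiv.swap_apply_right, swap_apply_succ_succ, h0, h1, if_true, Finset.prod_const_one,
      Equiv.Perm.sign_swap zero_ne_one, hy b a] at h2
    have h3 : ((Equiv.Perm.sign τ : ℤ) : ℝ) * y a b = 0 := by
      push_cast at h2
      linarith
    exact (mul_eq_zero.1 h3).resolve_left hs
  · intro e
    have e' := congrArg (fun σ => σ 0) e
    simp at e'
  · rintro σ ⟨hσ, hσ'⟩
    have : ∃ l : Fin k, σ l.succ.succ ≠ τ l.succ.succ := by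
      by_contra! hc
      rcases eq_one_or_swap (τ⁻¹ * σ) (fun l => by simp [hc l]) with e | e
      · exact hσ (inv_mul_eq_one.1 e).symm
      · exact hσ' (by rw [← e, mul_inv_cancel_left])
    obtain ⟨l, hl⟩ := this
    rw [Finset.prod_eq_zero (Finset.mem_univ l) (if_neg hl), mul_zero]

end Antisymmetrization

/-! ### Submanifolds in coordinates -/

namespace CoordExpr

variable {n m p : ℕ}

/-- On the open set `V`, the data `D` are those of an immersion into the open set `O` with a smooth
Riemannian metric, and of a smooth orthonormal frame of normal vector fields. -/
structure IsRegular (D : CoordExpr n m p) (O : Set (EuclideanSpace ℝ (Fin m)))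
    (V : Set (EuclideanSpace ℝ (Fin n))) : Prop where
  metric : IsMetricOn D.metric O
  isOpen : IsOpen V
  mem : ∀ u ∈ V, D.x u ∈ O
  smooth_x : ∀ u ∈ V, ContDiffAt ℝ ∞ D.x u
  smooth_normal : ∀ u ∈ V, ∀ A i, ContDiffAt ℝ ∞ (fun v => D.normal A v i) u
  orthonormal : ∀ u ∈ V, ∀ A B,
    pairing (D.gBar u) (D.normal A u) (D.normal B u) = if A = B then 1 else 0
  normal_e : ∀ u ∈ V, ∀ A a, pairing (D.gBar u) (D.normal A u) (D.e a u) = 0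
  linearIndependent : ∀ u ∈ V, LinearIndependent ℝ fun a => D.e a u

/-- The matrix of the connection form in the direction `e_a`. -/
noncomputable def connMatrix (D : CoordExpr n m p) (a : Fin n) (u : EuclideanSpace ℝ (Fin n)) :
    Matrix (Fin m) (Fin m) ℝ :=
  ∑ j, D.e a u j • christoffelMatrix D.metric j (D.x u)

lemma connMatrix_apply (D : CoordExpr n m p) (a : Fin n) (u : EuclideanSpace ℝ (Fin n))
    (i k : Fin m) : D.connMatrix a u i k = ∑ j, D.e a u j * D.GammaBar i j k u := by
  simp [connMatrix, christoffelMatrix, GammaBar, Matrix.sum_apply]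

lemma nablaBar_eq (D : CoordExpr n m p) (V : EuclideanSpace ℝ (Fin n) → Fin m → ℝ) (a : Fin n)
    (u : EuclideanSpace ℝ (Fin n)) :
    D.nablaBar V a u = (fun i => pd (fun v => V v i) a u) + D.connMatrix a u *ᵥ V u := by
  ext i
  simp only [nablaBar, Pi.add_apply, mulVec, dotProduct, connMatrix_apply, Finset.sum_mul]
  rw [Finset.sum_comm]
  congr 1
  exact Finset.sum_congr rfl fun k _ => Finset.sum_congr rfl fun j _ => by ring

lemma push_eq (D : CoordExpr n m p) (u : EuclideanSpace ℝ (Fin n)) (X : Fin n → ℝ) :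
    D.push u X = ∑ a, X a • D.e a u := by
  ext i; simp [push]

lemma pairing_push (D : CoordExpr n m p) (u : EuclideanSpace ℝ (Fin n)) (X Y : Fin n → ℝ) :
    pairing (D.gBar u) (D.push u X) (D.push u Y) = pairing (D.g u) X Y := by
  rw [push_eq, push_eq, pairing_sum_left]
  simp only [pairing_sum_right, pairing_smul_left, pairing_smul_right]
  exact Finset.sum_congr rfl fun a _ => Finset.sum_congr rfl fun b _ => by simp [g]; ring

namespace IsRegular

variable {D : CoordExpr n m p} {O : Set (EuclideanSpace ℝ (Fin m))}
  {U : Set (EuclideanSpace ℝ (Fin n))} (hD : D.IsRegular O U) {u : EuclideanSpace ℝ (Fin n)}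

include hD

lemma eventually (hu : u ∈ U) : ∀ᶠ v in nhds u, v ∈ U := hD.isOpen.eventually_mem hu

lemma smooth_comp (hu : u ∈ U) {F : EuclideanSpace ℝ (Fin m) → ℝ}
    (hF : ContDiffAt ℝ ∞ F (D.x u)) : ContDiffAt ℝ ∞ (fun v => F (D.x v)) u :=
  hF.comp u (hD.smooth_x u hu)

lemma smooth_gBar (hu : u ∈ U) : SmoothEntriesAt D.gBar u := fun i j =>
  hD.smooth_comp hu (hD.metric.smooth _ (hD.mem u hu) i j)

lemma smooth_GammaBar (hu : u ∈ U) (i j k : Fin m) : ContDiffAt ℝ ∞ (D.GammaBar i j k) u :=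
  hD.smooth_comp hu (hD.metric.smooth_christoffel (hD.mem u hu) i j k)

lemma smooth_x_apply (hu : u ∈ U) (i : Fin m) : ContDiffAt ℝ ∞ (fun v => D.x v i) u :=
  contDiffAt_euclidean.1 (hD.smooth_x u hu) i

lemma smooth_e (hu : u ∈ U) (a : Fin n) (i : Fin m) : ContDiffAt ℝ ∞ (fun v => D.e a v i) u :=
  contDiffAt_pd (hD.smooth_x_apply hu i) a

lemma smooth_connMatrix (hu : u ∈ U) (a : Fin n) : SmoothEntriesAt (D.connMatrix a) u :=
  fun i k => by
    simp only [connMatrix_apply]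
    exact ContDiffAt.sum fun j _ => (hD.smooth_e hu a j).mul (hD.smooth_GammaBar hu i j k)

lemma pd_e_comm (hu : u ∈ U) (a b : Fin n) (i : Fin m) :
    pd (fun v => D.e a v i) b u = pd (fun v => D.e b v i) a u :=
  pd_comm (hD.smooth_x_apply hu i) a b

lemma pd_comp (hu : u ∈ U) {F : EuclideanSpace ℝ (Fin m) → ℝ}
    (hF : ContDiffAt ℝ ∞ F (D.x u)) (a : Fin n) :
    pd (fun v => F (D.x v)) a u = ∑ q, D.e a u q * pd F q (D.x u) :=
  NambuCodazzi.pd_comp (diffAt hF) ((hD.smooth_x u hu).differentiableAt (by simp)) a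

lemma mpd_gBar (hu : u ∈ U) (a : Fin n) :
    mpd D.gBar a u = (D.connMatrix a u)ᵀ * D.gBar u + D.gBar u * D.connMatrix a u := by
  have h : mpd D.gBar a u = ∑ q, D.e a u q • mpd D.metric q (D.x u) := by
    ext i j
    simp only [mpd, Matrix.of_apply, gBar, Matrix.sum_apply, Matrix.smul_apply, smul_eq_mul]
    exact hD.pd_comp hu (hD.metric.smooth _ (hD.mem u hu) i j) a
  rw [h, connMatrix, transpose_sum, Finset.sum_mul, Finset.mul_sum, ← Finset.sum_add_distrib]
  refine Finset.sum_congr rfl fun q _ => ?_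
  rw [hD.metric.mpd_metric (hD.mem u hu), smul_add, transpose_smul, smul_mul_assoc,
    mul_smul_comm]
  rfl

lemma gBar_symm (hu : u ∈ U) : (D.gBar u).IsSymm := hD.metric.symm _ (hD.mem u hu)

lemma smooth_pairing (hu : u ∈ U) {V W : EuclideanSpace ℝ (Fin n) → Fin m → ℝ}
    (hV : ∀ i, ContDiffAt ℝ ∞ (fun v => V v i) u) (hW : ∀ i, ContDiffAt ℝ ∞ (fun v => W v i) u) :
    ContDiffAt ℝ ∞ (fun v => pairing (D.gBar v) (V v) (W v)) u :=
  ContDiffAt.sum fun i _ => ContDiffAt.sum fun j _ =>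
    ((hD.smooth_gBar hu i j).mul (hV i)).mul (hW j)

/-- The ambient covariant derivative is compatible with the metric. -/
lemma pd_pairing (hu : u ∈ U) {V W : EuclideanSpace ℝ (Fin n) → Fin m → ℝ}
    (hV : ∀ i, ContDiffAt ℝ ∞ (fun v => V v i) u) (hW : ∀ i, ContDiffAt ℝ ∞ (fun v => W v i) u)
    (a : Fin n) :
    pd (fun v => pairing (D.gBar v) (V v) (W v)) a u =
      pairing (D.gBar u) (D.nablaBar V a u) (W u) + pairing (D.gBar u) (V u) (D.nablaBar W a u) := by
  have h : pd (fun v => pairing (D.gBar v) (V v) (W v)) a u =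
      pairing (mpd D.gBar a u) (V u) (W u)
        + pairing (D.gBar u) (fun i => pd (fun v => V v i) a u) (W u)
        + pairing (D.gBar u) (V u) (fun i => pd (fun v => W v i) a u) := by
    have hg := fun i j => diffAt (hD.smooth_gBar hu i j)
    have hV' := fun i => diffAt (hV i)
    have hW' := fun i => diffAt (hW i)
    have h2 : ∀ i, DifferentiableAt ℝ (fun v => ∑ j, D.gBar v i j * V v i * W v j) u := fun i =>
      DifferentiableAt.fun_sum fun j _ => ((hg i j).fun_mul (hV' i)).fun_mul (hW' j)
    simp only [pairing, mpd, Matrix.of_apply]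
    rw [pd_sum _ (fun i _ => h2 i)]
    simp only [← Finset.sum_add_distrib]
    refine Finset.sum_congr rfl fun i _ => ?_
    rw [pd_sum _ (fun j _ => ((hg i j).fun_mul (hV' i)).fun_mul (hW' j))]
    refine Finset.sum_congr rfl fun j _ => ?_
    rw [pd_mul ((hg i j).fun_mul (hV' i)) (hW' j), pd_mul (hg i j) (hV' i)]
    ring
  rw [h, hD.mpd_gBar hu, nablaBar_eq, nablaBar_eq, pairing_add_left, pairing_add_right,
    pairing_add_mat, ← pairing_mulVec_left, ← pairing_mulVec_right]
  ring

/-- The ambient covariant derivative is torsion-free. -/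
lemma nablaBar_e_comm (hu : u ∈ U) (a b : Fin n) :
    D.nablaBar (D.e a) b u = D.nablaBar (D.e b) a u := by
  ext i
  simp only [nablaBar]
  rw [hD.pd_e_comm hu a b i, Finset.sum_comm]
  congr 1
  refine Finset.sum_congr rfl fun k _ => Finset.sum_congr rfl fun j _ => ?_
  rw [GammaBar, hD.metric.christoffel_symm (hD.mem u hu), GammaBar]
  ring

lemma isMetricOn_g : IsMetricOn D.g U where
  isOpen := hD.isOpen
  smooth u hu a b := hD.smooth_pairing hu (hD.smooth_e hu a) (hD.smooth_e hu b)
  symm u hu := by ext a b; exact pairing_comm (hD.gBar_symm hu) _ _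
  pos u hu X hX := by
    rw [← pairing_push]
    refine hD.metric.pos _ (hD.mem u hu) _ fun h0 => hX ?_
    have := Fintype.linearIndependent_iff.1 (hD.linearIndependent u hu) X (by
      rw [← h0, push_eq])
    exact funext this

/-- The tangential part of the ambient covariant derivative is the Levi-Civita connection. -/
lemma pairing_nablaBar_e (hu : u ∈ U) (a c d : Fin n) :
    pairing (D.gBar u) (D.nablaBar (D.e c) a u) (D.e d u) = ∑ f, D.g u d f * D.Gamma u f a c := by
  -- Koszul's formula: three instances of metric compatibility are combined with torsion-freeness.
  have hp : ∀ a b c, pd (fun v => D.g v b c) a u =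
      pairing (D.gBar u) (D.nablaBar (D.e b) a u) (D.e c u)
      + pairing (D.gBar u) (D.nablaBar (D.e c) a u) (D.e b u) := fun a b c => by
    rw [pairing_comm (hD.gBar_symm hu) (D.nablaBar (D.e c) a u)]
    exact hD.pd_pairing hu (hD.smooth_e hu b) (hD.smooth_e hu c) a
  unfold Gamma
  rw [hD.isMetricOn_g.sum_mul_christoffel hu, hp, hp, hp, hD.nablaBar_e_comm hu d a,
    hD.nablaBar_e_comm hu d c, hD.nablaBar_e_comm hu a c]
  ring

lemma smooth_nablaBar (hu : u ∈ U) {V : EuclideanSpace ℝ (Fin n) → Fin m → ℝ}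
    (hV : ∀ i, ContDiffAt ℝ ∞ (fun v => V v i) u) (a : Fin n) (i : Fin m) :
    ContDiffAt ℝ ∞ (fun v => D.nablaBar V a v i) u :=
  (contDiffAt_pd (hV i) a).add (ContDiffAt.sum fun j _ => ContDiffAt.sum fun k _ =>
    ((hD.smooth_GammaBar hu i j k).mul (hD.smooth_e hu a j)).mul (hV k))

/-- Cartan's structure equation `dω + ω ∧ ω = Ω`, pulled back to the submanifold. The terms
containing `∂_a e_b` are symmetric in `a, b` and cancel. -/
lemma riemann_comp (hu : u ∈ U) (a b : Fin n) :
    mpd (D.connMatrix b) a u - mpd (D.connMatrix a) b u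
      + (D.connMatrix a u * D.connMatrix b u - D.connMatrix b u * D.connMatrix a u)
    = ∑ k, ∑ l, (D.e a u k * D.e b u l) • riemannMatrix D.metric k l (D.x u) := by
  have h : ∀ a b, mpd (D.connMatrix b) a u = ∑ k, ∑ l, (D.e a u k * D.e b u l) •
      mpd (christoffelMatrix D.metric l) k (D.x u)
      + ∑ l, pd (fun v => D.e b v l) a u • christoffelMatrix D.metric l (D.x u) := by
    intro a b
    ext i j
    simp only [mpd, Matrix.of_apply, connMatrix_apply, Matrix.add_apply, Matrix.sum_apply,
      Matrix.smul_apply, smul_eq_mul]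
    rw [pd_sum _ (fun q _ => (diffAt (hD.smooth_e hu b q)).fun_mul
      (diffAt (hD.smooth_GammaBar hu i q j))), Finset.sum_comm, ← Finset.sum_add_distrib]
    refine Finset.sum_congr rfl fun l _ => ?_
    rw [pd_mul (diffAt (hD.smooth_e hu b l)) (diffAt (hD.smooth_GammaBar hu i l j))]
    have hc : pd (D.GammaBar i l j) a u = ∑ q, D.e a u q *
        pd (fun z => christoffelMatrix D.metric l z i j) q (D.x u) :=
      hD.pd_comp hu (hD.metric.smooth_christoffel (hD.mem u hu) i l j) a
    rw [hc, Finset.mul_sum, add_comm]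
    congr 1
    exact Finset.sum_congr rfl fun q _ => by ring
  have h2 : ∀ a b, D.connMatrix a u * D.connMatrix b u = ∑ k, ∑ l, (D.e a u k * D.e b u l) •
      (christoffelMatrix D.metric k (D.x u) * christoffelMatrix D.metric l (D.x u)) := by
    intro a b
    simp only [connMatrix, Finset.sum_mul, Finset.mul_sum, smul_mul_smul_comm]
    rw [Finset.sum_comm]
  have h3 : ∀ F : Fin m → Fin m → Matrix (Fin m) (Fin m) ℝ,
      ∑ k, ∑ l, (D.e b u k * D.e a u l) • F k l = ∑ k, ∑ l, (D.e a u k * D.e b u l) • F l k := by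
    intro F
    rw [Finset.sum_comm]
    simp only [mul_comm]
  simp only [h, h2, hD.pd_e_comm hu b a, h3]
  simp only [riemannMatrix_eq, smul_add, smul_sub, Finset.sum_add_distrib, Finset.sum_sub_distrib]
  abel

/-- The curvature of the ambient connection along the submanifold. -/
lemma nablaBar_nablaBar (hu : u ∈ U) {V : EuclideanSpace ℝ (Fin n) → Fin m → ℝ}
    (hV : ∀ i, ContDiffAt ℝ ∞ (fun v => V v i) u) (a b : Fin n) :
    D.nablaBar (D.nablaBar V b) a u - D.nablaBar (D.nablaBar V a) b u =
      curvature D.metric (D.x u) (D.e a u) (D.e b u) (V u) := by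
  -- The second derivatives of `V`, and the two terms with its first derivatives taken together, are
  -- symmetric in `a, b`. Only the terms of `riemann_comp` survive the commutator.
  have h : ∀ a b, D.nablaBar (D.nablaBar V b) a u =
      (fun i => pd (fun v => pd (fun w => V w i) b v) a u) + mpd (D.connMatrix b) a u *ᵥ V u
        + D.connMatrix b u *ᵥ (fun i => pd (fun v => V v i) a u)
        + D.connMatrix a u *ᵥ (fun i => pd (fun v => V v i) b u)
        + (D.connMatrix a u * D.connMatrix b u) *ᵥ V u := by
    intro a b
    rw [nablaBar_eq, nablaBar_eq D V b u, mulVec_add, mulVec_mulVec]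
    have h1 : (fun i => pd (fun v => D.nablaBar V b v i) a u) =
        (fun i => pd (fun v => pd (fun w => V w i) b v) a u) + mpd (D.connMatrix b) a u *ᵥ V u
        + D.connMatrix b u *ᵥ (fun i => pd (fun v => V v i) a u) := by
      ext i
      have hc := fun q => diffAt (hD.smooth_connMatrix hu b i q)
      have hV' := fun q => diffAt (hV q)
      simp only [nablaBar_eq, Pi.add_apply, mulVec, dotProduct, mpd, Matrix.of_apply]
      rw [pd_add (diffAt (contDiffAt_pd (hV i) b))
        (DifferentiableAt.fun_sum fun q _ => (hc q).fun_mul (hV' q)),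
        pd_sum _ (fun q _ => (hc q).fun_mul (hV' q)), add_assoc, ← Finset.sum_add_distrib]
      congr 1
      exact Finset.sum_congr rfl fun q _ => pd_mul (hc q) (hV' q) a
    rw [h1]
    abel
  have hs : (fun i => pd (fun v => pd (fun w => V w i) a v) b u) =
      fun i => pd (fun v => pd (fun w => V w i) b v) a u := funext fun i => pd_comm (hV i) a b
  have hR : curvature D.metric (D.x u) (D.e a u) (D.e b u) (V u) =
      (∑ k, ∑ l, (D.e a u k * D.e b u l) • riemannMatrix D.metric k l (D.x u)) *ᵥ V u := by
    simp only [curvature_eq_sum, Matrix.sum_mulVec, Matrix.smul_mulVec]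
  rw [h, h, hs, hR, ← hD.riemann_comp hu, add_mulVec, sub_mulVec, sub_mulVec]
  abel

end IsRegular

end CoordExpr

/-! ### The Codazzi–Mainardi equation -/

namespace CoordExpr

variable {n m p : ℕ}

/-- The Codazzi–Mainardi equation in terms of its components. -/
lemma codazziMainardi_iff (D : CoordExpr n m p)
    (h : Fin p → EuclideanSpace ℝ (Fin n) → Matrix (Fin n) (Fin n) ℝ)
    (θ : Fin p → Fin p → EuclideanSpace ℝ (Fin n) → Fin n → ℝ)
    (A : Fin p) (u : EuclideanSpace ℝ (Fin n)) :
    D.CodazziMainardi h θ A u ↔ ∀ a b c : Fin n,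
      pairing (D.gBar u) (curvature D.metric (D.x u) (D.e a u) (D.e b u) (D.e c u)) (D.normal A u)
        = D.nablaForm (h A) u a b c - D.nablaForm (h A) u b a c
            + ∑ B, (θ B A u a * h B u b c - θ B A u b * h B u a c) := by
  constructor
  · intro H a b c
    have e := H (Pi.single a 1) (Pi.single b 1) (Pi.single c 1)
    have hp : ∀ a, D.push u (Pi.single a 1) = D.e a u := fun a => by
      rw [push_eq, Finset.sum_eq_single a] <;> simp +contextual
    rw [hp, hp, hp] at e
    rw [e, Finset.sum_eq_single a, Finset.sum_eq_single b, Finset.sum_eq_single c] <;>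
      simp +contextual
  · intro H X Y Z
    have e : ∀ a b c, curvatureₗ D.metric (D.x u) (D.e a u) (D.e b u) (D.e c u) (D.normal A u) = _ :=
      fun a b c => (curvatureₗ_apply _ _ _ _).trans (H a b c)
    refine (curvatureₗ_apply _ _ _ _).symm.trans ?_
    simp only [push_eq, map_sum, map_smul, LinearMap.sum_apply, LinearMap.smul_apply, e,
      smul_eq_mul, Finset.mul_sum]
    rw [Finset.sum_comm, Finset.sum_congr rfl fun b _ => Finset.sum_comm, Finset.sum_comm]
    refine Finset.sum_congr rfl fun a _ => Finset.sum_congr rfl fun b _ =>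
      Finset.sum_congr rfl fun c _ => by ring

namespace IsRegular

variable {D : CoordExpr n m p} {O : Set (EuclideanSpace ℝ (Fin m))}
  {U : Set (EuclideanSpace ℝ (Fin n))} (hD : D.IsRegular O U) {u : EuclideanSpace ℝ (Fin n)}

include hD

/-- The tangent vectors and the normal vectors span. -/
lemma eq_zero_of_orthogonal (hm : m = n + p) (hu : u ∈ U) (V : Fin m → ℝ)
    (he : ∀ a, pairing (D.gBar u) V (D.e a u) = 0)
    (hN : ∀ A, pairing (D.gBar u) V (D.normal A u) = 0) : V = 0 := by
  have hli : LinearIndependent ℝ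
      (Sum.elim (fun a => D.e a u) fun A => D.normal A u : Fin n ⊕ Fin p → Fin m → ℝ) := by
    rw [Fintype.linearIndependent_iff]
    intro c hc
    rw [Fintype.sum_sum_type] at hc
    simp only [Sum.elim_inl, Sum.elim_inr] at hc
    have hr : ∀ A, c (Sum.inr A) = 0 := by
      intro A
      have e := congrArg (pairing (D.gBar u) (D.normal A u)) hc
      have e0 : pairing (D.gBar u) (D.normal A u) 0 = 0 := by simp [← pairingₗ_apply]
      simpa [pairing_add_right, pairing_sum_right, pairing_smul_right, hD.normal_e u hu,
        hD.orthonormal u hu, e0] using e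
    simp only [hr, zero_smul, Finset.sum_const_zero, add_zero] at hc
    have hl := Fintype.linearIndependent_iff.1 (hD.linearIndependent u hu) _ hc
    rintro (a | A)
    · exact hl a
    · exact hr A
  -- By `m = n + p` these independent vectors span, so `V` pairs to zero with everything, itself
  -- included, against positivity.
  have hspan := hli.span_eq_top_of_card_eq_finrank' (by simp [hm])
  have hz : pairingₗ (D.gBar u) V = 0 := by
    refine LinearMap.ext_on_range hspan ?_
    rintro (a | A)
    · exact he a
    · exact hN A
  by_contra hV
  have := hD.metric.pos _ (hD.mem u hu) V hV
  have h0 := congrArg (fun L => L V) hz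
  simp only [pairingₗ_apply, LinearMap.zero_apply] at h0
  exact this.ne' h0

lemma smooth_nablaBar_normal (hu : u ∈ U) (A : Fin p) (a : Fin n) (i : Fin m) :
    ContDiffAt ℝ ∞ (fun v => D.nablaBar (D.normal A) a v i) u :=
  hD.smooth_nablaBar hu (hD.smooth_normal u hu A) a i

/-- The second fundamental form in terms of the derivative of the normal vector field. -/
lemma pairing_nablaBar_normal_e (hu : u ∈ U) (A : Fin p) (b c : Fin n) :
    pairing (D.gBar u) (D.nablaBar (D.normal A) b u) (D.e c u) = -D.h A u b c := by
  have h := hD.pd_pairing hu (hD.smooth_normal u hu A) (hD.smooth_e hu c) b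
  -- Orthogonality holds on a neighbourhood of `u`, so it may be differentiated.
  have h0 : pd (fun v => pairing (D.gBar v) (D.normal A v) (D.e c v)) b u = 0 :=
    (pd_congr ((hD.eventually hu).mono fun v hv => hD.normal_e v hv A c) b).trans (pd_const 0 b)
  rw [h0, pairing_comm (hD.gBar_symm hu) (D.normal A u)] at h
  simp only [CoordExpr.h, Matrix.of_apply]
  linarith

/-- The relation `g(W_A(X), Y) = h_A(X, Y)`: the inverse metric in the definition of `W` is undone
by lowering the index. -/
lemma sum_W_mul_g (hu : u ∈ U) (A : Fin p) (b c : Fin n) :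
    ∑ d, D.W A u d b * D.g u d c = D.h A u b c := by
  set F : Fin n → ℝ := D.h A u b with hF
  have h : (fun d => D.W A u d b) = (D.g u)⁻¹ *ᵥ F := by
    ext d
    simp only [W, Matrix.of_apply, hD.pairing_nablaBar_normal_e hu, mulVec, dotProduct, hF]
    rw [← Finset.sum_neg_distrib]
    exact Finset.sum_congr rfl fun c _ => by ring
  have h2 : (D.g u *ᵥ fun d => D.W A u d b) c = F c := by
    rw [h, mulVec_mulVec, hD.isMetricOn_g.mul_inv hu, one_mulVec]
  rw [← h2]
  simp only [mulVec, dotProduct]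
  exact Finset.sum_congr rfl fun d _ => by
    rw [(hD.isMetricOn_g.symm u hu).apply c d]; ring

lemma W_transpose_mul_g (hu : u ∈ U) (A : Fin p) : (D.W A u)ᵀ * D.g u = D.h A u := by
  ext b c
  simpa [Matrix.mul_apply] using hD.sum_W_mul_g hu A b c

omit hD in
/-- Weingarten's formula. -/
lemma nablaBar_normal_eq (A : Fin p) (b : Fin n) :
    D.nablaBar (D.normal A) b u = D.normalDeriv A b u - ∑ d, D.W A u d b • D.e d u := by
  ext i
  simp [normalDeriv]

lemma pairing_normalDeriv_e (hu : u ∈ U) (A : Fin p) (b c : Fin n) :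
    pairing (D.gBar u) (D.normalDeriv A b u) (D.e c u) = 0 := by
  have h := hD.pairing_nablaBar_normal_e hu A b c
  rw [nablaBar_normal_eq, pairing_sub_left, pairing_sum_left] at h
  simp only [pairing_smul_left] at h
  rw [← hD.sum_W_mul_g hu A b c] at h
  simp only [g, Matrix.of_apply] at h
  linarith

lemma normalDeriv_eq (hm : m = n + p) (hu : u ∈ U) (A : Fin p) (b : Fin n) :
    D.normalDeriv A b u = ∑ B, D.normalConn A B u b • D.normal B u := by
  refine sub_eq_zero.1 (hD.eq_zero_of_orthogonal hm hu _ (fun a => ?_) fun B => ?_)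
  · simp [pairing_sub_left, pairing_sum_left, pairing_smul_left, hD.normal_e u hu,
      hD.pairing_normalDeriv_e hu]
  · simp [pairing_sub_left, pairing_sum_left, pairing_smul_left, hD.orthonormal u hu, normalConn]

lemma normalConn_eq (hu : u ∈ U) (A B : Fin p) (b : Fin n) :
    D.normalConn A B u b = pairing (D.gBar u) (D.nablaBar (D.normal A) b u) (D.normal B u) := by
  rw [nablaBar_normal_eq, pairing_sub_left, pairing_sum_left, normalConn]
  simp [pairing_smul_left, pairing_comm (hD.gBar_symm hu) (D.e _ u), hD.normal_e u hu]

lemma normalConn_skew (hu : u ∈ U) (A B : Fin p) (b : Fin n) :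
    D.normalConn A B u b = -D.normalConn B A u b := by
  have h := hD.pd_pairing hu (hD.smooth_normal u hu A) (hD.smooth_normal u hu B) b
  have h0 : pd (fun v => pairing (D.gBar v) (D.normal A v) (D.normal B v)) b u = 0 :=
    (pd_congr ((hD.eventually hu).mono fun v hv => hD.orthonormal v hv A B) b).trans (pd_const _ b)
  rw [h0, pairing_comm (hD.gBar_symm hu) (D.normal A u), ← hD.normalConn_eq hu,
    ← hD.normalConn_eq hu] at h
  linarith

/-- The cross term in the derivative of `h_A`. By Weingarten's formula its normal part supplies the
normal-connection terms of the Codazzi–Mainardi equation, and its tangential part supplies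
Christoffel terms of `∇h_A`. -/
lemma pairing_nablaBar_normal_nablaBar_e (hm : m = n + p) (hu : u ∈ U) (A : Fin p)
    (a b c : Fin n) :
    pairing (D.gBar u) (D.nablaBar (D.normal A) b u) (D.nablaBar (D.e c) a u) =
      -∑ B, D.normalConn B A u b * D.h B u a c - ∑ f, D.Gamma u f a c * D.h A u b f := by
  rw [nablaBar_normal_eq, hD.normalDeriv_eq hm hu, pairing_sub_left, pairing_sum_left,
    pairing_sum_left]
  simp only [pairing_smul_left]
  congr 1
  · rw [← Finset.sum_neg_distrib]
    refine Finset.sum_congr rfl fun B _ => ?_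
    rw [hD.normalConn_skew hu A B, pairing_comm (hD.gBar_symm hu)]
    simp [CoordExpr.h]
  · simp only [pairing_comm (hD.gBar_symm hu) (D.e _ u), hD.pairing_nablaBar_e hu,
      ← hD.sum_W_mul_g hu, Finset.mul_sum]
    rw [Finset.sum_comm]
    exact Finset.sum_congr rfl fun f _ => Finset.sum_congr rfl fun d _ => by ring

/-- The Codazzi–Mainardi equation. -/
theorem codazziMainardi (hm : m = n + p) (hu : u ∈ U) (A : Fin p) :
    D.CodazziMainardi D.h D.normalConn A u := by
  rw [codazziMainardi_iff]
  intro a b c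
  have hpd : ∀ a b, pd (fun v => D.h A v b c) a u =
      -(pairing (D.gBar u) (D.nablaBar (D.nablaBar (D.normal A) b) a u) (D.e c u)
        + pairing (D.gBar u) (D.nablaBar (D.normal A) b u) (D.nablaBar (D.e c) a u)) := by
    intro a b
    rw [← hD.pd_pairing hu (hD.smooth_nablaBar_normal hu A b) (hD.smooth_e hu c), ← pd_neg]
    exact pd_congr ((hD.eventually hu).mono fun v hv => by
      rw [hD.pairing_nablaBar_normal_e hv, neg_neg]) a
  have hG : ∀ d, D.Gamma u d a b = D.Gamma u d b a := fun d =>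
    hD.isMetricOn_g.christoffel_symm hu d a b
  have hs : ∀ X Y Z W, pairing (D.gBar u) (curvature D.metric (D.x u) X Y Z) W =
      -pairing (D.gBar u) (curvature D.metric (D.x u) X Y W) Z :=
    hD.metric.curvature_skew (hD.mem u hu)
  -- Skew-adjointness moves the curvature onto `N_A`, where it is the commutator of two covariant
  -- derivatives; by `hpd` that commutator appears in the skew part of `∂h_A`.
  rw [hs, ← hD.nablaBar_nablaBar hu (hD.smooth_normal u hu A)]
  rw [pairing_sub_left]
  simp only [nablaForm, hpd, hD.pairing_nablaBar_normal_nablaBar_e hm hu, hG,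
    Finset.sum_sub_distrib]
  ring

/-- Lowering an index commutes with `∇` because the induced metric is parallel. -/
lemma nablaForm_transpose_mul_g (hu : u ∈ U)
    {W : EuclideanSpace ℝ (Fin n) → Matrix (Fin n) (Fin n) ℝ} (hW : SmoothEntriesAt W u)
    (c a b : Fin n) :
    D.nablaForm (fun v => (W v)ᵀ * D.g v) u c a b = ∑ d, D.nablaEnd W u c d a * D.g u d b := by
  have h1 : ∀ T : EuclideanSpace ℝ (Fin n) → Matrix (Fin n) (Fin n) ℝ,
      (Matrix.of fun a b => D.nablaForm T u c a b) = mpd T c u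
        - (christoffelMatrix D.g c u)ᵀ * T u - T u * christoffelMatrix D.g c u := by
    intro T
    ext a b
    simp [nablaForm, mpd, christoffelMatrix, Gamma, Matrix.mul_apply, mul_comm (T u _ _)]
  have h2 : (Matrix.of fun a b => D.nablaEnd W u c a b) = mpd W c u
        + christoffelMatrix D.g c u * W u - W u * christoffelMatrix D.g c u := by
    ext a b
    simp [nablaEnd, mpd, christoffelMatrix, Gamma, Matrix.mul_apply, mul_comm (W u _ _)]
  have h3 : (Matrix.of fun a b => D.nablaForm (fun v => (W v)ᵀ * D.g v) u c a b) =
      (Matrix.of fun a b => D.nablaEnd W u c a b)ᵀ * D.g u := by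
    rw [h1, h2, mpd_mul hW.transpose (hD.isMetricOn_g.smooth u hu), mpd_transpose,
      hD.isMetricOn_g.mpd_metric hu, transpose_sub, transpose_add, transpose_mul, transpose_mul]
    noncomm_ring
  have h4 := congrFun (congrFun h3 a) b
  simpa [Matrix.mul_apply] using h4

/-- The Codazzi–Mainardi equation for Weingarten maps. -/
lemma codazziMainardi_transpose_mul_g_iff (hu : u ∈ U)
    {W : Fin p → EuclideanSpace ℝ (Fin n) → Matrix (Fin n) (Fin n) ℝ}
    (θ : Fin p → Fin p → EuclideanSpace ℝ (Fin n) → Fin n → ℝ)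
    {A : Fin p} (hW : SmoothEntriesAt (W A) u) :
    D.CodazziMainardi (fun B u => (W B u).transpose * D.g u) θ A u ↔ ∀ a b c : Fin n,
      pairing (D.gBar u) (curvature D.metric (D.x u) (D.e a u) (D.e b u) (D.e c u)) (D.normal A u)
        = ∑ d, D.calW W θ A u a b d * D.g u d c := by
  rw [codazziMainardi_iff]
  refine forall_congr' fun a => forall_congr' fun b => forall_congr' fun c => Eq.congr rfl ?_
  rw [hD.nablaForm_transpose_mul_g hu hW, hD.nablaForm_transpose_mul_g hu hW]
  simp only [calW, add_mul, sub_mul, Finset.sum_add_distrib, Finset.sum_sub_distrib,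
    Matrix.mul_apply, Matrix.transpose_apply, Finset.sum_mul, Finset.mul_sum, mul_assoc]
  congr 2
  · rw [Finset.sum_comm]
  · rw [Finset.sum_comm]

lemma nablaForm_congr {T T' : EuclideanSpace ℝ (Fin n) → Matrix (Fin n) (Fin n) ℝ}
    (h : ∀ v ∈ U, T v = T' v) (hu : u ∈ U) (c a b : Fin n) :
    D.nablaForm T u c a b = D.nablaForm T' u c a b := by
  simp only [nablaForm, h u hu]
  rw [pd_congr ((hD.eventually hu).mono fun v hv => by rw [h v hv])]

/-- The relation `Wᵀ g = h` holds on all of `U`, hence also for first derivatives. -/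
lemma codazziMainardi_h_iff (hu : u ∈ U)
    (θ : Fin p → Fin p → EuclideanSpace ℝ (Fin n) → Fin n → ℝ) (A : Fin p) :
    D.CodazziMainardi (fun B u => (D.W B u).transpose * D.g u) θ A u ↔
      D.CodazziMainardi D.h θ A u := by
  simp only [codazziMainardi_iff, hD.W_transpose_mul_g hu,
    hD.nablaForm_congr (T := fun v => (D.W A v)ᵀ * D.g v)
      (fun v hv => hD.W_transpose_mul_g hv A) hu]

lemma smooth_W (hu : u ∈ U) (A : Fin p) : SmoothEntriesAt (D.W A) u := fun a b =>
  (ContDiffAt.sum fun c _ => ((hD.isMetricOn_g.smooth u hu).inv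
    (hD.isMetricOn_g.det_pos hu).ne' a c).mul
      (hD.smooth_pairing hu (hD.smooth_nablaBar_normal hu A b) (hD.smooth_e hu c))).neg

end IsRegular

end CoordExpr

/-! ### Nambu brackets, `𝒫²` and the Nambu identity -/

lemma sum_comm_pairs {ι κ : Type*} [Fintype ι] [Fintype κ] (F : ι → ι → κ → κ → ℝ) :
    ∑ i, ∑ j, ∑ a, ∑ b, F i j a b = ∑ a, ∑ b, ∑ i, ∑ j, F i j a b := by
  have e1 : ∀ i, ∑ j, ∑ a, ∑ b, F i j a b = ∑ a, ∑ b, ∑ j, F i j a b := fun i => by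
    rw [Finset.sum_comm]
    exact Finset.sum_congr rfl fun a _ => Finset.sum_comm
  simp only [e1]
  rw [Finset.sum_comm]
  exact Finset.sum_congr rfl fun a _ => Finset.sum_comm

lemma sum_comm_triple {ι κ : Type*} [Fintype ι] [Fintype κ] (F : ι → ι → ι → κ → ℝ) :
    ∑ i, ∑ j, ∑ l, ∑ a, F i j l a = ∑ a, ∑ i, ∑ j, ∑ l, F i j l a := by
  have e1 : ∀ i j, ∑ l, ∑ a, F i j l a = ∑ a, ∑ l, F i j l a := fun i j => Finset.sum_comm
  have e2 : ∀ i, ∑ j, ∑ a, ∑ l, F i j l a = ∑ a, ∑ j, ∑ l, F i j l a := fun i => Finset.sum_comm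
  simp only [e1, e2]
  exact Finset.sum_comm

namespace CoordExpr

variable {k m p : ℕ}

lemma bracket_eq (D : CoordExpr (k + 2) m p)
    (F₀ : EuclideanSpace ℝ (Fin (k + 2)) → ℝ) (F : Fin (k + 1) → EuclideanSpace ℝ (Fin (k + 2)) → ℝ)
    (u : EuclideanSpace ℝ (Fin (k + 2))) :
    D.bracket (Matrix.vecCons F₀ F) u = 1 / D.density u *
      ∑ σ : Equiv.Perm (Fin (k + 2)), ((Equiv.Perm.sign σ : ℤ) : ℝ) *
        (pd F₀ (σ 0) u * ∏ t, pd (F t) (σ t.succ) u) := by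
  simp [bracket, Fin.prod_univ_succ (n := k + 1)]

lemma bracketWith_eq (D : CoordExpr (k + 2) m p)
    (f : Fin k → EuclideanSpace ℝ (Fin (k + 2)) → ℝ)
    (g₁ g₂ : EuclideanSpace ℝ (Fin (k + 2)) → ℝ) (u : EuclideanSpace ℝ (Fin (k + 2))) :
    D.bracketWith f g₁ g₂ u = 1 / D.density u *
      ∑ σ : Equiv.Perm (Fin (k + 2)), ((Equiv.Perm.sign σ : ℤ) : ℝ) *
        (pd g₁ (σ 0) u * pd g₂ (σ 1) u) * ∏ l : Fin k, pd (f l) (σ l.succ.succ) u := by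
  rw [bracketWith, bracket_eq]
  congr 1
  refine Finset.sum_congr rfl fun σ _ => ?_
  rw [Fin.prod_univ_succ]
  simp only [Matrix.cons_val_zero, Matrix.cons_val_succ, Fin.succ_zero_eq_one]
  ring

/-- The ambient metric contracted with tangent vectors in the last `n - 1` slots becomes `g_ab`, so
the two ε-symbols contract as in `sum_perm_sum_perm`. The factor `(n - 1)!` produced there cancels
the normalization of `𝒫`. -/
lemma PSqUpper_eq_adjugate (D : CoordExpr (k + 2) m p) (u : EuclideanSpace ℝ (Fin (k + 2)))
    (i l : Fin m) :
    D.PSqUpper u i l = 1 / D.density u ^ 2 *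
      ∑ a, ∑ b, D.e a u i * D.e b u l * (D.g u).adjugate b a := by
  set ρ := D.density u with hρ
  set s : Equiv.Perm (Fin (k + 2)) → ℝ := fun σ => ((Equiv.Perm.sign σ : ℤ) : ℝ) with hs
  have hP : ∀ i J, D.P u i J = 1 / √((k + 1).factorial : ℝ) * (1 / ρ * ∑ σ,
      s σ * (D.e (σ 0) u i * ∏ t, D.e (σ t.succ) u (J t))) := fun i J => by
    rw [P, bracket_eq]; rfl
  have hsq : 1 / √((k + 1).factorial : ℝ) * (1 / √((k + 1).factorial : ℝ)) *
      ((k + 1).factorial : ℝ) = 1 := by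
    have h0 : ((k + 1).factorial : ℝ) ≠ 0 := by positivity
    rw [div_mul_div_comm, Real.mul_self_sqrt (by positivity)]
    field_simp
  -- The sum over both multi-indices factorizes slot by slot.
  have hprod : ∀ σ τ : Equiv.Perm (Fin (k + 2)), ∑ I : Fin (k + 1) → Fin m,
      ∑ J : Fin (k + 1) → Fin m, (∏ t, D.e (σ t.succ) u (I t)) * (∏ t, D.e (τ t.succ) u (J t)) *
        (∏ t, D.gBar u (I t) (J t)) = ∏ t : Fin (k + 1), D.g u (σ t.succ) (τ t.succ) := by
    intro σ τ
    have h := sum_sum_prod_eq fun (t : Fin (k + 1)) (i j : Fin m) =>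
      D.gBar u i j * D.e (σ t.succ) u i * D.e (τ t.succ) u j
    refine Eq.trans ?_ h
    refine Finset.sum_congr rfl fun I _ => Finset.sum_congr rfl fun J _ => ?_
    simp only [Finset.prod_mul_distrib]
    ring
  have hmain : D.PSqUpper u i l = 1 / √((k + 1).factorial : ℝ) *
      (1 / √((k + 1).factorial : ℝ)) * (1 / ρ ^ 2) * ∑ σ, ∑ τ, s σ * s τ *
        (D.e (σ 0) u i * D.e (τ 0) u l * ∏ t : Fin (k + 1), D.g u (σ t.succ) (τ t.succ)) := by
    simp only [← hprod, PSqUpper, hP]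
    have h1 : ∀ I J : Fin (k + 1) → Fin m,
        (1 / √((k + 1).factorial : ℝ) * (1 / ρ * ∑ σ,
          s σ * (D.e (σ 0) u i * ∏ t, D.e (σ t.succ) u (I t)))) *
        (1 / √((k + 1).factorial : ℝ) * (1 / ρ * ∑ σ,
          s σ * (D.e (σ 0) u l * ∏ t, D.e (σ t.succ) u (J t)))) * ∏ t, D.gBar u (I t) (J t)
        = 1 / √((k + 1).factorial : ℝ) * (1 / √((k + 1).factorial : ℝ)) * (1 / ρ ^ 2) *
          ∑ σ, ∑ τ, s σ * s τ * (D.e (σ 0) u i * D.e (τ 0) u l *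
            ((∏ t, D.e (σ t.succ) u (I t)) * (∏ t, D.e (τ t.succ) u (J t)) *
              ∏ t, D.gBar u (I t) (J t))) := by
      intro I J
      have h2 : ∀ a b : Equiv.Perm (Fin (k + 2)) → ℝ, ∀ c d e : ℝ,
          (c * (d * ∑ σ, a σ)) * (c * (d * ∑ σ, b σ)) * e =
            c * c * (d * d) * ∑ σ, ∑ τ, a σ * b τ * e := by
        intro a b c d e
        have := Finset.sum_mul_sum Finset.univ Finset.univ a b
        simp only [← Finset.sum_mul]
        rw [← this]; ring
      rw [h2]
      congr 1
      · ring
      · exact Finset.sum_congr rfl fun σ _ => Finset.sum_congr rfl fun τ _ => by ring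
    simp only [h1, ← Finset.mul_sum]
    congr 1
    rw [sum_comm_pairs]
    simp only [Finset.mul_sum]
  rw [hmain, sum_perm_sum_perm (D.g u) (fun a => D.e a u i) fun a => D.e a u l]
  linear_combination (1 / ρ ^ 2 *
    ∑ a, ∑ b, D.e a u i * D.e b u l * (D.g u).adjugate b a) * hsq

/-- The coefficient matrices of the bracket expression in the Nambu identity. -/
noncomputable def bracketMatrix (D : CoordExpr (k + 2) m p) (u : EuclideanSpace ℝ (Fin (k + 2)))
    (a b : Fin (k + 2)) : Matrix (Fin m) (Fin m) ℝ :=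
  (Matrix.of fun j j' => ∑ l, D.e a u l * pd (D.GammaBar j l j') b u)
    - D.connMatrix a u * D.connMatrix b u

lemma bracket_expression_eq (D : CoordExpr (k + 2) m p)
    (f : Fin k → EuclideanSpace ℝ (Fin (k + 2)) → ℝ) (u : EuclideanSpace ℝ (Fin (k + 2)))
    (j j' : Fin m) :
    (∑ l, D.bracketWith f (fun v => D.x v l) (D.GammaBar j l j') u
      - ∑ l, ∑ q, ∑ r, D.bracketWith f (fun v => D.x v l) (fun v => D.x v q) u
          * D.GammaBar r q j' u * D.GammaBar j l r u)
    = 1 / D.density u * ∑ σ : Equiv.Perm (Fin (k + 2)), ((Equiv.Perm.sign σ : ℤ) : ℝ) *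
        D.bracketMatrix u (σ 0) (σ 1) j j' * ∏ l : Fin k, pd (f l) (σ l.succ.succ) u := by
  have h : ∀ a b, D.bracketMatrix u a b j j' = ∑ l, D.e a u l * pd (D.GammaBar j l j') b u
      - ∑ l, ∑ q, ∑ r, D.e a u l * D.e b u q * D.GammaBar r q j' u * D.GammaBar j l r u := by
    intro a b
    simp only [bracketMatrix, Matrix.sub_apply, Matrix.of_apply, Matrix.mul_apply,
      connMatrix_apply, Finset.sum_mul_sum]
    congr 1
    rw [Finset.sum_comm]
    refine Finset.sum_congr rfl fun l _ => ?_
    rw [Finset.sum_comm]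
    exact Finset.sum_congr rfl fun q _ => Finset.sum_congr rfl fun r _ => by ring
  simp only [h, bracketWith_eq, mul_sub, sub_mul, Finset.sum_sub_distrib]
  congr 1
  · simp only [Finset.mul_sum, Finset.sum_mul]
    rw [Finset.sum_comm]
    rfl
  · simp only [Finset.mul_sum, Finset.sum_mul]
    rw [sum_comm_triple]
    exact Finset.sum_congr rfl fun σ _ => Finset.sum_congr rfl fun l _ =>
      Finset.sum_congr rfl fun q _ => Finset.sum_congr rfl fun r _ => by simp only [e]; ring

lemma bracket_expression_eq_antisymm (D : CoordExpr (k + 2) m p)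
    (f : Fin k → EuclideanSpace ℝ (Fin (k + 2)) → ℝ) (u : EuclideanSpace ℝ (Fin (k + 2)))
    (j j' : Fin m) :
    (∑ l, D.bracketWith f (fun v => D.x v l) (D.GammaBar j l j') u
      - ∑ l, ∑ q, ∑ r, D.bracketWith f (fun v => D.x v l) (fun v => D.x v q) u
          * D.GammaBar r q j' u * D.GammaBar j l r u)
    = 1 / D.density u * ((1 / 2) * ∑ σ : Equiv.Perm (Fin (k + 2)),
        ((Equiv.Perm.sign σ : ℤ) : ℝ) *
        (D.bracketMatrix u (σ 0) (σ 1) j j' - D.bracketMatrix u (σ 1) (σ 0) j j') *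
          ∏ l : Fin k, pd (f l) (σ l.succ.succ) u) :=
  (D.bracket_expression_eq f u j j').trans (congrArg (1 / D.density u * ·)
    (sum_perm_antisymm (fun a b => D.bracketMatrix u a b j j') fun l a => pd (f l) a u))

namespace IsRegular

variable {D : CoordExpr (k + 2) m p} {O : Set (EuclideanSpace ℝ (Fin m))}
  {U : Set (EuclideanSpace ℝ (Fin (k + 2)))} (hD : D.IsRegular O U)
  {u : EuclideanSpace ℝ (Fin (k + 2))}

include hD

lemma gamma_sq (hu : u ∈ U) : D.gamma u ^ 2 = (D.g u).det / D.density u ^ 2 := by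
  rw [gamma, div_pow, Real.sq_sqrt (hD.isMetricOn_g.det_pos hu).le]

/-- `𝒫²` is `γ²` times the tangential projection. -/
lemma sum_PSq_mul (hu : u ∈ U) (i : Fin m) (V : Fin m → ℝ) :
    ∑ j, D.PSq u i j * V j = D.gamma u ^ 2 *
      ∑ a, D.e a u i * ((D.g u)⁻¹ *ᵥ fun b => pairing (D.gBar u) (D.e b u) V) a := by
  -- The inverse of a symmetric matrix is symmetric, so the order of the indices is harmless.
  have hadj : ∀ a b, (D.g u).adjugate b a = (D.g u).det * (D.g u)⁻¹ a b := by
    intro a b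
    have h1 : (D.g u).det ≠ 0 := (hD.isMetricOn_g.det_pos hu).ne'
    have h2 : ((D.g u)⁻¹)ᵀ = (D.g u)⁻¹ := by
      rw [Matrix.transpose_nonsing_inv, (hD.isMetricOn_g.symm u hu).eq]
    rw [← h2, Matrix.transpose_apply, Matrix.inv_def]
    simp [h1]
  simp only [PSq, PSqUpper_eq_adjugate, hadj, hD.gamma_sq hu, mulVec, dotProduct, pairing,
    Finset.mul_sum, Finset.sum_mul]
  rw [Finset.sum_comm, sum_comm_pairs]
  exact Finset.sum_congr rfl fun a _ => Finset.sum_congr rfl fun b _ =>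
    Finset.sum_congr rfl fun l _ => Finset.sum_congr rfl fun j _ => by ring

/-- By the product rule, `e_a^l ∂_b Γ_l` is `∂_b` of the connection matrix up to a term in `∂_b
e_a`, which is symmetric. The skew part is therefore the left side of `riemann_comp` with the
opposite sign. -/
lemma bracketMatrix_sub (hu : u ∈ U) (a b : Fin (k + 2)) (V : Fin m → ℝ) :
    (D.bracketMatrix u a b - D.bracketMatrix u b a) *ᵥ V =
      -curvature D.metric (D.x u) (D.e a u) (D.e b u) V := by
  have h : ∀ a b, D.bracketMatrix u a b = mpd (D.connMatrix a) b u
      - ∑ l, pd (fun v => D.e a v l) b u • christoffelMatrix D.metric l (D.x u)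
      - D.connMatrix a u * D.connMatrix b u := by
    intro a b
    rw [bracketMatrix]
    congr 1
    ext i j
    simp only [Matrix.sub_apply, Matrix.of_apply, mpd, connMatrix_apply, Matrix.sum_apply,
      Matrix.smul_apply, smul_eq_mul]
    rw [pd_sum _ (fun q _ => (diffAt (hD.smooth_e hu a q)).fun_mul
      (diffAt (hD.smooth_GammaBar hu i q j))), ← Finset.sum_sub_distrib]
    refine Finset.sum_congr rfl fun l _ => ?_
    rw [pd_mul (diffAt (hD.smooth_e hu a l)) (diffAt (hD.smooth_GammaBar hu i l j))]
    simp [christoffelMatrix, GammaBar]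
  have h2 : D.bracketMatrix u a b - D.bracketMatrix u b a =
      -∑ k, ∑ l, (D.e a u k * D.e b u l) • riemannMatrix D.metric k l (D.x u) := by
    rw [← hD.riemann_comp hu, h, h]
    simp only [hD.pd_e_comm hu a b]
    abel
  rw [h2, curvature_eq_sum, neg_mulVec]
  simp only [Matrix.sum_mulVec, Matrix.smul_mulVec]

/-- The difference of the two sides of the Nambu identity. -/
lemma nambuIdentity_iff (hu : u ∈ U) (hρ : D.density u ≠ 0)
    (W : Fin p → EuclideanSpace ℝ (Fin (k + 2)) → Matrix (Fin (k + 2)) (Fin (k + 2)) ℝ)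
    (θ : Fin p → Fin p → EuclideanSpace ℝ (Fin (k + 2)) → Fin (k + 2) → ℝ)
    (A : Fin p) (f : Fin k → EuclideanSpace ℝ (Fin (k + 2)) → ℝ) :
    D.NambuIdentity W θ A f u ↔ ∀ c, ∑ σ : Equiv.Perm (Fin (k + 2)),
      ((Equiv.Perm.sign σ : ℤ) : ℝ) * (D.calW W θ A u (σ 0) (σ 1) c -
        ((D.g u)⁻¹ *ᵥ fun d => pairing (D.gBar u) (curvature D.metric (D.x u) (D.e (σ 0) u)
          (D.e (σ 1) u) (D.e d u)) (D.normal A u)) c) *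
        ∏ l : Fin k, pd (f l) (σ l.succ.succ) u = 0 := by
  set Q : Fin (k + 2) → Fin (k + 2) → Fin (k + 2) → ℝ := fun a b d => pairing (D.gBar u)
    (curvature D.metric (D.x u) (D.e a u) (D.e b u) (D.e d u)) (D.normal A u) with hQ
  set s : Equiv.Perm (Fin (k + 2)) → ℝ := fun σ => ((Equiv.Perm.sign σ : ℤ) : ℝ) *
    ∏ l : Fin k, pd (f l) (σ l.succ.succ) u with hs
  set c₀ : ℝ := 1 / (2 * D.density u) with hc₀
  have hY : ∀ c, ∑ σ : Equiv.Perm (Fin (k + 2)),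
      ((Equiv.Perm.sign σ : ℤ) : ℝ) * (D.calW W θ A u (σ 0) (σ 1) c -
        ((D.g u)⁻¹ *ᵥ Q (σ 0) (σ 1)) c) * ∏ l : Fin k, pd (f l) (σ l.succ.succ) u =
      ∑ σ, s σ * D.calW W θ A u (σ 0) (σ 1) c - ∑ σ, s σ * ((D.g u)⁻¹ *ᵥ Q (σ 0) (σ 1)) c := by
    intro c
    rw [← Finset.sum_sub_distrib]
    exact Finset.sum_congr rfl fun σ _ => by simp only [hs]; ring
  have hL : ∀ i, D.calC W θ A f u i =
      c₀ * ∑ c, (∑ σ, s σ * D.calW W θ A u (σ 0) (σ 1) c) * D.e c u i := by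
    intro i
    simp only [calC, push, Finset.mul_sum, Finset.sum_mul]
    rw [Finset.sum_comm]
    exact Finset.sum_congr rfl fun c _ => Finset.sum_congr rfl fun σ _ => by
      simp only [hs, hc₀]; ring
  set V : Fin m → ℝ := fun j => ∑ j',
    (∑ l, D.bracketWith f (fun v => D.x v l) (D.GammaBar j l j') u
      - ∑ l, ∑ q, ∑ r, D.bracketWith f (fun v => D.x v l) (fun v => D.x v q) u
          * D.GammaBar r q j' u * D.GammaBar j l r u) * D.normal A u j' with hV
  -- The factor `1/2` in `c₀` comes from antisymmetrizing, and matches the `1/(2ρ)` in the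
  -- definition of `𝒞_A`.
  have hV' : V = ∑ σ, (-(c₀ * s σ)) •
      curvature D.metric (D.x u) (D.e (σ 0) u) (D.e (σ 1) u) (D.normal A u) := by
    have h1 : ∀ σ : Equiv.Perm (Fin (k + 2)), (-(c₀ * s σ)) •
        curvature D.metric (D.x u) (D.e (σ 0) u) (D.e (σ 1) u) (D.normal A u) =
        (c₀ * s σ) • ((D.bracketMatrix u (σ 0) (σ 1) - D.bracketMatrix u (σ 1) (σ 0)) *ᵥ
          D.normal A u) := fun σ => by
      rw [hD.bracketMatrix_sub hu, smul_neg, neg_smul]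
    simp only [h1]
    ext j
    simp only [hV, bracket_expression_eq_antisymm, Finset.sum_apply, Pi.smul_apply, smul_eq_mul,
      mulVec, dotProduct, Matrix.sub_apply]
    simp only [Finset.mul_sum, Finset.sum_mul]
    rw [Finset.sum_comm]
    exact Finset.sum_congr rfl fun σ _ => Finset.sum_congr rfl fun j' _ => by
      simp only [hs, hc₀]; field_simp
  have hskew : ∀ a b d, pairing (D.gBar u) (D.e d u)
      (curvature D.metric (D.x u) (D.e a u) (D.e b u) (D.normal A u)) = -Q a b d := fun a b d => by
    rw [pairing_comm (hD.gBar_symm hu)]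
    exact hD.metric.curvature_skew (hD.mem u hu) _ _ _ _
  have hQV : (fun b => pairing (D.gBar u) (D.e b u) V) = ∑ σ, (c₀ * s σ) • Q (σ 0) (σ 1) := by
    ext b
    simp only [hV', pairing_sum_right, pairing_smul_right, hskew, Finset.sum_apply,
      Pi.smul_apply, smul_eq_mul, neg_mul_neg]
  have hR : ∀ i, ∑ j, D.PSq u i j * V j = D.gamma u ^ 2 * (c₀ *
      ∑ c, (∑ σ, s σ * ((D.g u)⁻¹ *ᵥ Q (σ 0) (σ 1)) c) * D.e c u i) := by
    intro i
    rw [hD.sum_PSq_mul hu, hQV, Matrix.mulVec_sum]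
    simp only [Matrix.mulVec_smul, Finset.sum_apply, Pi.smul_apply, smul_eq_mul, Finset.mul_sum,
      Finset.sum_mul]
    exact Finset.sum_congr rfl fun c _ => Finset.sum_congr rfl fun σ _ => by ring
  -- Both sides are this nonzero factor times combinations of the `e_c`, whose linear independence
  -- lets the coefficients be compared.
  have hγ : D.gamma u ^ 2 * c₀ ≠ 0 := by
    rw [hD.gamma_sq hu]
    have := (hD.isMetricOn_g.det_pos hu).ne'
    positivity
  have hN : D.NambuIdentity W θ A f u ↔
      ∀ i, D.gamma u ^ 2 * D.calC W θ A f u i = ∑ j, D.PSq u i j * V j := Iff.rfl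
  refine hN.trans ?_
  change _ ↔ ∀ c, ∑ σ : Equiv.Perm (Fin (k + 2)),
      ((Equiv.Perm.sign σ : ℤ) : ℝ) * (D.calW W θ A u (σ 0) (σ 1) c -
        ((D.g u)⁻¹ *ᵥ Q (σ 0) (σ 1)) c) * ∏ l : Fin k, pd (f l) (σ l.succ.succ) u = 0
  simp only [hY, hL, hR]
  constructor
  · intro H
    refine Fintype.linearIndependent_iff.1 (hD.linearIndependent u hu) _ ?_
    ext i
    have := H i
    rw [← mul_assoc, ← mul_assoc] at this
    have := mul_left_cancel₀ hγ this
    simpa [sub_mul, sub_eq_zero] using this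
  · intro H i
    simp only [sub_eq_zero] at H
    simp only [H]

/-- The Nambu identity is equivalent to the Codazzi–Mainardi equation. -/
theorem codazziMainardi_iff_nambuIdentity (hu : u ∈ U) (hρ : D.density u ≠ 0)
    {W : Fin p → EuclideanSpace ℝ (Fin (k + 2)) → Matrix (Fin (k + 2)) (Fin (k + 2)) ℝ}
    (θ : Fin p → Fin p → EuclideanSpace ℝ (Fin (k + 2)) → Fin (k + 2) → ℝ)
    {A : Fin p} (hW : SmoothEntriesAt (W A) u)
    {𝓕 : Set (Fin k → EuclideanSpace ℝ (Fin (k + 2)) → ℝ)}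
    (h𝓕 : ∀ c : Fin k → Fin (k + 2), ∃ f ∈ 𝓕, ∀ l a, pd (f l) a u = if a = c l then 1 else 0) :
    D.CodazziMainardi (fun B u => (W B u).transpose * D.g u) θ A u ↔
      ∀ f ∈ 𝓕, D.NambuIdentity W θ A f u := by
  set Q : Fin (k + 2) → Fin (k + 2) → Fin (k + 2) → ℝ := fun a b d => pairing (D.gBar u)
    (curvature D.metric (D.x u) (D.e a u) (D.e b u) (D.e d u)) (D.normal A u) with hQ
  -- Lowering by the invertible matrix `g` turns the equation for bilinear forms into one for
  -- vectors.
  have hiff : D.CodazziMainardi (fun B u => (W B u).transpose * D.g u) θ A u ↔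
      ∀ a b, D.calW W θ A u a b - (D.g u)⁻¹ *ᵥ Q a b = 0 := by
    rw [hD.codazziMainardi_transpose_mul_g_iff hu θ hW]
    refine forall_congr' fun a => forall_congr' fun b => ?_
    have h1 : ∀ c, ∑ d, D.calW W θ A u a b d * D.g u d c =
        (D.g u *ᵥ D.calW W θ A u a b) c := fun c => by
      simp only [mulVec, dotProduct]
      exact Finset.sum_congr rfl fun d _ => by
        rw [(hD.isMetricOn_g.symm u hu).apply c d]; ring
    simp only [h1]
    rw [sub_eq_zero]
    constructor
    · intro H
      have : Q a b = D.g u *ᵥ D.calW W θ A u a b := funext H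
      rw [this, mulVec_mulVec, hD.isMetricOn_g.inv_mul hu, one_mulVec]
    · intro H c
      rw [H, mulVec_mulVec, hD.isMetricOn_g.mul_inv hu, one_mulVec]
  rw [hiff]
  constructor
  · intro H f _
    rw [hD.nambuIdentity_iff hu hρ]
    intro c
    refine Finset.sum_eq_zero fun σ _ => ?_
    have := congrFun (H (σ 0) (σ 1)) c
    simp only [Pi.sub_apply, Pi.zero_apply, hQ] at this
    rw [this]; ring
  · intro H a b
    ext c
    refine eq_zero_of_sum_perm_eq_zero
      (fun a b => (D.calW W θ A u a b - (D.g u)⁻¹ *ᵥ Q a b) c) (fun a b => ?_) (fun s => ?_) a b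
    · have h1 : D.calW W θ A u a b = -D.calW W θ A u b a := by
        ext c
        simp only [calW, Pi.neg_apply, Finset.sum_sub_distrib]
        ring
      have h2 : Q a b = -Q b a := by
        ext d
        simp only [hQ, Pi.neg_apply]
        rw [curvature_swap, pairing_neg_left]
      rw [h1, h2, mulVec_neg]
      simp only [Pi.sub_apply, Pi.neg_apply]
      ring
    -- Functions whose differentials at `u` are coordinate covectors turn the product of derivatives
    -- into the indicator used by `eq_zero_of_sum_perm_eq_zero`.
    · obtain ⟨f, hf, hs⟩ := h𝓕 s
      have := (hD.nambuIdentity_iff hu hρ W θ A f).1 (H f hf) c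
      simp only [hs] at this
      exact this

/-- If the curvature has no normal component on tangent vectors, then `𝒞_A` vanishes. -/
lemma calC_eq_zero (hm : m = k + 2 + p) (hu : u ∈ U) (A : Fin p)
    (hR : ∀ a b c, pairing (D.gBar u)
      (curvature D.metric (D.x u) (D.e a u) (D.e b u) (D.e c u)) (D.normal A u) = 0)
    (f : Fin k → EuclideanSpace ℝ (Fin (k + 2)) → ℝ) :
    D.calC D.W D.normalConn A f u = 0 := by
  have h := (hD.codazziMainardi_transpose_mul_g_iff hu D.normalConn (hD.smooth_W hu A)).1
    ((hD.codazziMainardi_h_iff hu _ A).2 (hD.codazziMainardi hm hu A))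
  have h0 : ∀ a b, D.calW D.W D.normalConn A u a b = 0 := by
    intro a b
    have h1 : D.g u *ᵥ D.calW D.W D.normalConn A u a b = 0 := by
      ext c
      rw [Pi.zero_apply, ← hR a b c, h a b c]
      simp only [mulVec, dotProduct]
      exact Finset.sum_congr rfl fun d _ => by
        rw [(hD.isMetricOn_g.symm u hu).apply c d]; ring
    have h2 := congrArg ((D.g u)⁻¹ *ᵥ ·) h1
    simpa [mulVec_mulVec, hD.isMetricOn_g.inv_mul hu] using h2
  ext i
  simp [calC, h0, push]

end IsRegular

end CoordExpr

/-! ### Riemannian metrics in charts -/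

open Bundle

section Manifold

variable {m : ℕ} {M : Type*} [TopologicalSpace M] [ChartedSpace (EuclideanSpace ℝ (Fin m)) M]

lemma mdifferentiable_of_mem_maximalAtlas
    {φ : OpenPartialHomeomorph M (EuclideanSpace ℝ (Fin m))}
    (hφ : φ ∈ IsManifold.maximalAtlas (𝓡 m) ∞ M) : φ.MDifferentiable (𝓡 m) (𝓡 m) :=
  ⟨(contMDiffOn_of_mem_maximalAtlas hφ).mdifferentiableOn (by simp),
    (contMDiffOn_symm_of_mem_maximalAtlas hφ).mdifferentiableOn (by simp)⟩

/-- The derivative of the inverse of a chart. -/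
noncomputable def dsymm (φ : OpenPartialHomeomorph M (EuclideanSpace ℝ (Fin m)))
    (y : EuclideanSpace ℝ (Fin m)) : EuclideanSpace ℝ (Fin m) →L[ℝ] EuclideanSpace ℝ (Fin m) :=
  mfderiv (𝓡 m) (𝓡 m) φ.symm y

lemma dsymm_injective {φ : OpenPartialHomeomorph M (EuclideanSpace ℝ (Fin m))}
    (hφ : φ ∈ IsManifold.maximalAtlas (𝓡 m) ∞ M) {y : EuclideanSpace ℝ (Fin m)}
    (hy : y ∈ φ.target) : Function.Injective (dsymm φ y) :=
  (mdifferentiable_of_mem_maximalAtlas hφ).symm.mfderiv_injective hy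

/-- The derivative of a chart. -/
noncomputable def dchart (φ : OpenPartialHomeomorph M (EuclideanSpace ℝ (Fin m)))
    (q : M) : EuclideanSpace ℝ (Fin m) →L[ℝ] EuclideanSpace ℝ (Fin m) :=
  mfderiv (𝓡 m) (𝓡 m) φ q

lemma dsymm_dchart {φ : OpenPartialHomeomorph M (EuclideanSpace ℝ (Fin m))}
    (hφ : φ ∈ IsManifold.maximalAtlas (𝓡 m) ∞ M) {q : M} (hq : q ∈ φ.source)
    (w : EuclideanSpace ℝ (Fin m)) : dsymm φ (φ q) (dchart φ q w) = w :=
  congrArg (fun L => L w) ((mdifferentiable_of_mem_maximalAtlas hφ).symm_comp_deriv hq)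

variable [IsManifold (𝓡 m) ∞ M]

/-- The inner product of two tangent vectors at `q`, as elements of the model space. -/
noncomputable def tangentInner (gM : Metric m M) (q : M) (v w : EuclideanSpace ℝ (Fin m)) : ℝ :=
  gM.inner q (v : TangentSpace (𝓡 m) q) (w : TangentSpace (𝓡 m) q)

lemma pairing_metricInChart (gM : Metric m M)
    (φ : OpenPartialHomeomorph M (EuclideanSpace ℝ (Fin m))) (y : EuclideanSpace ℝ (Fin m))
    (V W : EuclideanSpace ℝ (Fin m)) :
    pairing (metricInChart gM φ y) V.ofLp W.ofLp =
      tangentInner gM (φ.symm y) (dsymm φ y V) (dsymm φ y W) := by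
  have hs : ∀ V : EuclideanSpace ℝ (Fin m),
      dsymm φ y V = ∑ i, V i • dsymm φ y (EuclideanSpace.single i 1) := fun V => by
    conv_lhs => rw [← (EuclideanSpace.basisFun (Fin m) ℝ).sum_repr V]
    simp
  let b : EuclideanSpace ℝ (Fin m) →ₗ[ℝ] EuclideanSpace ℝ (Fin m) →ₗ[ℝ] ℝ :=
    LinearMap.mk₂ ℝ (tangentInner gM (φ.symm y))
      (fun v v' w => by simp only [tangentInner]; erw [map_add]; rfl)
      (fun c v w => by simp only [tangentInner]; erw [map_smul]; rfl)
      (fun v w w' => by simp only [tangentInner]; erw [map_add])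
      (fun c v w => by simp only [tangentInner]; erw [map_smul])
  change _ = b (dsymm φ y V) (dsymm φ y W)
  rw [hs V, hs W]
  simp only [map_sum, map_smul, LinearMap.sum_apply, LinearMap.smul_apply, smul_eq_mul, pairing,
    Finset.mul_sum]
  rw [Finset.sum_comm]
  exact Finset.sum_congr rfl fun j _ => Finset.sum_congr rfl fun i _ => by
    change tangentInner gM (φ.symm y) (dsymm φ y (EuclideanSpace.single i 1))
      (dsymm φ y (EuclideanSpace.single j 1)) * _ * _ = _ * (_ * b _ _)
    change b _ _ * _ * _ = _
    ring

lemma tangentInner_comm (gM : Metric m M) (q : M) (v w : EuclideanSpace ℝ (Fin m)) :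
    tangentInner gM q v w = tangentInner gM q w v := gM.symm q _ _

lemma tangentInner_pos (gM : Metric m M) (q : M) {v : EuclideanSpace ℝ (Fin m)} (hv : v ≠ 0) :
    0 < tangentInner gM q v v := gM.pos q _ hv

/-- The inner product of two smooth vector fields along a map is smooth. -/
lemma contDiffAt_tangentInner {n : ℕ} (gM : Metric m M)
    {σ τ : EuclideanSpace ℝ (Fin n) → TangentBundle (𝓡 m) M} {u : EuclideanSpace ℝ (Fin n)}
    (hσ : ContMDiffAt (𝓡 n) (𝓡 m).tangent ∞ σ u) (hτ : ContMDiffAt (𝓡 n) (𝓡 m).tangent ∞ τ u)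
    (h : ∀ᶠ v in nhds u, (σ v).proj = (τ v).proj) :
    ContDiffAt ℝ ∞ (fun v => tangentInner gM (σ v).proj (σ v).2 (τ v).2) u := by
  -- The vectors of `τ` are re-attached to the base points of `σ`, so that both fields lie over the
  -- same map.
  have hτ' : ContMDiffAt (𝓡 n) (𝓡 m).tangent ∞
      (fun v => (⟨(σ v).proj, (τ v).2⟩ : TangentBundle (𝓡 m) M)) u := by
    refine hτ.congr_of_eventuallyEq (h.mono fun v hv => ?_)
    exact congrArg (fun q => (⟨q, (τ v).2⟩ : TangentBundle (𝓡 m) M)) hv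
  have hb : ContMDiffAt (𝓡 n) (𝓡 m) ∞ (fun v => (σ v).proj) u :=
    (contMDiffAt_totalSpace.1 hσ).1
  have hg : ContMDiffAt (𝓡 m) ((𝓡 m).prod 𝓘(ℝ, EuclideanSpace ℝ (Fin m) →L[ℝ]
      EuclideanSpace ℝ (Fin m) →L[ℝ] ℝ)) ∞
      (fun b => TotalSpace.mk' (EuclideanSpace ℝ (Fin m) →L[ℝ] EuclideanSpace ℝ (Fin m) →L[ℝ] ℝ)
        b (gM.inner b)) (σ u).proj := gM.contMDiff.contMDiffAt
  have : ContMDiffAt (𝓡 n) ((𝓡 m).prod 𝓘(ℝ)) ∞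
      (fun v => TotalSpace.mk' ℝ (E := Bundle.Trivial M ℝ) ((σ v).proj)
        (gM.inner (σ v).proj (σ v).2 (τ v).2)) u := by
    apply ContMDiffAt.clm_bundle_apply₂ (F₁ := EuclideanSpace ℝ (Fin m))
      (F₂ := EuclideanSpace ℝ (Fin m))
    · exact hg.comp u hb
    · exact hσ
    · exact hτ'
  exact ((contMDiffAt_totalSpace.1 this).2).contDiffAt

/-- The field is the tangent map of `φ.symm` applied to a constant section. -/
lemma contMDiffAt_dsymm {φ : OpenPartialHomeomorph M (EuclideanSpace ℝ (Fin m))}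
    (hφ : φ ∈ IsManifold.maximalAtlas (𝓡 m) ∞ M) {y : EuclideanSpace ℝ (Fin m)}
    (hy : y ∈ φ.target) (w : EuclideanSpace ℝ (Fin m)) :
    ContMDiffAt (𝓡 m) (𝓡 m).tangent ∞
      (fun z => (⟨φ.symm z, dsymm φ z w⟩ : TangentBundle (𝓡 m) M)) y := by
  have h1 := (contMDiffOn_symm_of_mem_maximalAtlas hφ).contMDiffOn_tangentMapWithin
    (m := ∞) (by simp) φ.open_target.uniqueMDiffOn
  have h2 : ContMDiffAt (𝓡 m) (𝓡 m).tangent ∞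
      (fun z => (⟨z, w⟩ : TangentBundle (𝓡 m) (EuclideanSpace ℝ (Fin m)))) y :=
    contMDiffAt_vectorSpace_iff_contDiffAt.2 contDiffAt_const
  have h3 := (h1.contMDiffAt ((φ.open_target.preimage (FiberBundle.continuous_proj _ _)).mem_nhds
    (x := (⟨y, w⟩ : TangentBundle (𝓡 m) (EuclideanSpace ℝ (Fin m)))) hy)).comp y h2
  refine h3.congr_of_eventuallyEq ((φ.open_target.eventually_mem hy).mono fun z hz => ?_)
  simp only [Function.comp_apply, tangentMapWithin, dsymm,
    mfderivWithin_of_isOpen φ.open_target hz]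
  rfl

lemma isMetricOn_metricInChart (gM : Metric m M)
    {φ : OpenPartialHomeomorph M (EuclideanSpace ℝ (Fin m))}
    (hφ : φ ∈ IsManifold.maximalAtlas (𝓡 m) ∞ M) : IsMetricOn (metricInChart gM φ) φ.target where
  isOpen := φ.open_target
  smooth y hy i j := contDiffAt_tangentInner gM (contMDiffAt_dsymm hφ hy _)
    (contMDiffAt_dsymm hφ hy _) (Filter.Eventually.of_forall fun _ => rfl)
  symm y hy := by ext i j; exact tangentInner_comm gM _ _ _
  pos y hy V hV := by
    have h := pairing_metricInChart gM φ y (WithLp.toLp 2 V) (WithLp.toLp 2 V)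
    rw [h]
    refine tangentInner_pos gM _ fun h0 => hV ?_
    have := dsymm_injective hφ hy (h0.trans (map_zero _).symm)
    simpa using this

end Manifold

/-! ### Embedded submanifolds in charts -/

lemma isOpen_image_source {S M E F : Type*} [TopologicalSpace S] [TopologicalSpace M]
    [TopologicalSpace E] [TopologicalSpace F] {ι : S → M} {φ : OpenPartialHomeomorph M F}
    {ψ : OpenPartialHomeomorph S E} (hι : Continuous ι) :
    IsOpen (ψ '' (ψ.source ∩ ι ⁻¹' φ.source)) :=
  ψ.isOpen_image_of_subset_source (ψ.open_source.inter (φ.open_source.preimage hι))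
    Set.inter_subset_left

/-- A point of the submanifold in the domain of the coordinates. -/
lemma coordExpr_point {S M E F : Type*} [TopologicalSpace S] [TopologicalSpace M]
    [TopologicalSpace E] [TopologicalSpace F] {ι : S → M} {φ : OpenPartialHomeomorph M F}
    {ψ : OpenPartialHomeomorph S E} {u : E} (hu : u ∈ ψ '' (ψ.source ∩ ι ⁻¹' φ.source)) :
    u ∈ ψ.target ∧ ψ.symm u ∈ ψ.source ∧ ι (ψ.symm u) ∈ φ.source := by
  obtain ⟨s, ⟨hs, hs'⟩, rfl⟩ := hu
  rw [ψ.left_inv hs]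
  exact ⟨ψ.map_source hs, hs, hs'⟩

section Submanifold

variable {m n p : ℕ} {M : Type*} [TopologicalSpace M]
  [ChartedSpace (EuclideanSpace ℝ (Fin m)) M]
  {S : Type*} [TopologicalSpace S] [ChartedSpace (EuclideanSpace ℝ (Fin n)) S]

/-- The differential of an immersion is injective. -/
lemma mfderiv_injective_of_isImmersionAt {ι : S → M} {s : S}
    (h : Manifold.IsImmersionAt (𝓡 n) (𝓡 m) ∞ ι s) :
    Function.Injective (mfderiv (𝓡 n) (𝓡 m) ι s) := by
  set e := h.domChart
  set e' := h.codChart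
  have he := mdifferentiable_of_mem_maximalAtlas h.domChart_mem_maximalAtlas
  have he' := mdifferentiable_of_mem_maximalAtlas h.codChart_mem_maximalAtlas
  -- In the charts of the immersion `ι` is `v ↦ (v, 0)` up to a linear equivalence. The projection
  -- `L` undoes it, so `L ∘ e' ∘ ι` is the chart `e`, whose derivative is injective.
  set L : EuclideanSpace ℝ (Fin m) →L[ℝ] EuclideanSpace ℝ (Fin n) :=
    (ContinuousLinearMap.fst ℝ _ _).comp h.equiv.symm.toContinuousLinearMap
  have hs := h.mem_domChart_source
  have hc := h.mem_codChart_source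
  have hι : MDifferentiableAt (𝓡 n) (𝓡 m) ι s := h.contMDiffAt.mdifferentiableAt (by simp)
  have hloc : (L ∘ e') ∘ ι =ᶠ[nhds s] e := by
    filter_upwards [e.open_source.mem_nhds hs] with t ht
    have ht' : e t ∈ (h.domChart.extend (𝓡 n)).target := by simpa using e.map_source ht
    have h1 := h.writtenInCharts ht'
    simp only [Function.comp_apply, OpenPartialHomeomorph.extend_coe,
      OpenPartialHomeomorph.extend_coe_symm, modelWithCornersSelf_coe,
      modelWithCornersSelf_coe_symm, id] at h1
    rw [e.left_inv ht] at h1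
    simp [L, e', h1]
  have hL : MDifferentiableAt (𝓡 m) (𝓡 n) (L ∘ e') (ι s) :=
    L.mdifferentiableAt.comp _ (he'.mdifferentiableAt hc)
  have h2 : mfderiv (𝓡 n) (𝓡 n) e s =
      (mfderiv (𝓡 m) (𝓡 n) (L ∘ e') (ι s)).comp (mfderiv (𝓡 n) (𝓡 m) ι s) := by
    rw [← mfderiv_comp s hL hι]
    exact hloc.mfderiv_eq.symm
  have h3 := he.mfderiv_injective hs
  rw [h2] at h3
  exact Function.Injective.of_comp (f := mfderiv (𝓡 m) (𝓡 n) (L ∘ e') (ι s)) h3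

variable {ι : S → M}
  {φ : OpenPartialHomeomorph M (EuclideanSpace ℝ (Fin m))}
  {ψ : OpenPartialHomeomorph S (EuclideanSpace ℝ (Fin n))}

lemma contDiffAt_coordExpr_x (hι : ContMDiff (𝓡 n) (𝓡 m) ∞ ι)
    (hφ : φ ∈ IsManifold.maximalAtlas (𝓡 m) ∞ M) (hψ : ψ ∈ IsManifold.maximalAtlas (𝓡 n) ∞ S)
    {u : EuclideanSpace ℝ (Fin n)} (hu : u ∈ ψ '' (ψ.source ∩ ι ⁻¹' φ.source)) :
    ContDiffAt ℝ ∞ (fun v => φ (ι (ψ.symm v))) u := by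
  obtain ⟨h1, h2, h3⟩ := coordExpr_point hu
  exact (((contMDiffOn_of_mem_maximalAtlas hφ).contMDiffAt (φ.open_source.mem_nhds h3)).comp u
    ((hι (ψ.symm u)).comp u ((contMDiffOn_symm_of_mem_maximalAtlas hψ).contMDiffAt
      (ψ.open_target.mem_nhds h1)))).contDiffAt

/-- The tangent vectors of the submanifold in coordinates. -/
lemma dsymm_fderiv (hι : ContMDiff (𝓡 n) (𝓡 m) ∞ ι)
    (hφ : φ ∈ IsManifold.maximalAtlas (𝓡 m) ∞ M) (hψ : ψ ∈ IsManifold.maximalAtlas (𝓡 n) ∞ S)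
    {u : EuclideanSpace ℝ (Fin n)} (hu : u ∈ ψ '' (ψ.source ∩ ι ⁻¹' φ.source))
    (w : EuclideanSpace ℝ (Fin n)) :
    dsymm φ (φ (ι (ψ.symm u))) (fderiv ℝ (fun v => φ (ι (ψ.symm v))) u w) =
      (mfderiv (𝓡 n) (𝓡 m) ι (ψ.symm u) (mfderiv (𝓡 n) (𝓡 n) ψ.symm u w) :) := by
  obtain ⟨h1, h2, h3⟩ := coordExpr_point hu
  have hx : MDifferentiableAt (𝓡 n) (𝓡 m) (fun v => φ (ι (ψ.symm v))) u :=
    (contDiffAt_coordExpr_x hι hφ hψ hu).contMDiffAt.mdifferentiableAt (by simp)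
  have hs : MDifferentiableAt (𝓡 m) (𝓡 m) φ.symm (φ (ι (ψ.symm u))) :=
    (mdifferentiable_of_mem_maximalAtlas hφ).mdifferentiableAt_symm (φ.map_source h3)
  have hp : MDifferentiableAt (𝓡 n) (𝓡 n) ψ.symm u :=
    (mdifferentiable_of_mem_maximalAtlas hψ).mdifferentiableAt_symm h1
  have hi : MDifferentiableAt (𝓡 n) (𝓡 m) ι (ψ.symm u) := (hι _).mdifferentiableAt (by simp)
  have heq : φ.symm ∘ (fun v => φ (ι (ψ.symm v))) =ᶠ[nhds u] ι ∘ ψ.symm := by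
    filter_upwards [(isOpen_image_source (ψ := ψ) (φ := φ) hι.continuous).mem_nhds hu] with v hv
    exact φ.left_inv (coordExpr_point hv).2.2
  have e1 := mfderiv_comp u hs hx
  have e2 := mfderiv_comp u hi hp
  rw [heq.mfderiv_eq, e2, mfderiv_eq_fderiv] at e1
  exact (congrArg (fun L => L w) e1).symm

lemma isRegular_coordExpr [IsManifold (𝓡 m) ∞ M] [IsManifold (𝓡 n) ∞ S] {gM : Metric m M}
    {N : Fin p → ∀ s : S, TangentSpace (𝓡 m) (ι s)} {ρ : S → ℝ}
    (hι : Manifold.IsSmoothEmbedding (𝓡 n) (𝓡 m) ∞ ι)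
    (hφ : φ ∈ IsManifold.maximalAtlas (𝓡 m) ∞ M) (hψ : ψ ∈ IsManifold.maximalAtlas (𝓡 n) ∞ S)
    (hN : IsNormalFrameOn n gM ι N (ψ.source ∩ ι ⁻¹' φ.source)) :
    (coordExpr gM ι N φ ψ ρ).IsRegular φ.target (ψ '' (ψ.source ∩ ι ⁻¹' φ.source)) := by
  set D := coordExpr gM ι N φ ψ ρ with hD
  have hιs := hι.contMDiff
  have hmet := isMetricOn_metricInChart gM hφ
  have hop := isOpen_image_source (ψ := ψ) (φ := φ) hιs.continuous
  have hx : ∀ u ∈ ψ '' (ψ.source ∩ ι ⁻¹' φ.source), ContDiffAt ℝ ∞ D.x u := fun u hu =>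
    contDiffAt_coordExpr_x hιs hφ hψ hu
  have he : ∀ u ∈ ψ '' (ψ.source ∩ ι ⁻¹' φ.source), ∀ a,
      D.e a u = (fderiv ℝ (fun v => φ (ι (ψ.symm v))) u (EuclideanSpace.single a 1)).ofLp := by
    intro u hu a
    ext i
    have h1 := ((EuclideanSpace.proj (𝕜 := ℝ) i).hasFDerivAt.comp u
      ((hx u hu).differentiableAt (by simp)).hasFDerivAt).fderiv
    exact congrArg (fun L => L (EuclideanSpace.single a 1)) h1
  have hpair : ∀ u ∈ ψ '' (ψ.source ∩ ι ⁻¹' φ.source), ∀ V W : EuclideanSpace ℝ (Fin m),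
      pairing (D.gBar u) V.ofLp W.ofLp = tangentInner gM (ι (ψ.symm u))
        (dsymm φ (φ (ι (ψ.symm u))) V) (dsymm φ (φ (ι (ψ.symm u))) W) := by
    intro u hu V W
    have h := pairing_metricInChart gM φ (φ (ι (ψ.symm u))) V W
    rwa [φ.left_inv (coordExpr_point hu).2.2] at h
  have hNV : ∀ u ∈ ψ '' (ψ.source ∩ ι ⁻¹' φ.source), ∀ A, ∀ V : EuclideanSpace ℝ (Fin m),
      pairing (D.gBar u) (D.normal A u) V.ofLp = tangentInner gM (ι (ψ.symm u))
        (N A (ψ.symm u)) (dsymm φ (φ (ι (ψ.symm u))) V) := fun u hu A V =>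
    (hpair u hu (dchart φ (ι (ψ.symm u)) (N A (ψ.symm u))) V).trans
      (congrArg (fun w => tangentInner gM _ w _) (dsymm_dchart hφ (coordExpr_point hu).2.2 _))
  have hmem : ∀ u ∈ ψ '' (ψ.source ∩ ι ⁻¹' φ.source),
      ψ.symm u ∈ ψ.source ∩ ι ⁻¹' φ.source := fun u hu =>
    ⟨(coordExpr_point hu).2.1, (coordExpr_point hu).2.2⟩
  refine ⟨hmet, hop, fun u hu => φ.map_source (coordExpr_point hu).2.2, hx, ?_, ?_, ?_, ?_⟩
  · intro u hu A i
    obtain ⟨h1, h2, h3⟩ := coordExpr_point hu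
    have hN' : ContMDiffAt (𝓡 n) (𝓡 m).tangent ∞
        (fun v => (⟨ι (ψ.symm v), N A (ψ.symm v)⟩ : TangentBundle (𝓡 m) M)) u :=
      ((hN.smooth A).contMDiffAt ((ψ.open_source.inter
        (φ.open_source.preimage hιs.continuous)).mem_nhds (hmem u hu))).comp u
        ((contMDiffOn_symm_of_mem_maximalAtlas hψ).contMDiffAt (ψ.open_target.mem_nhds h1))
    have hE : ∀ j, ContMDiffAt (𝓡 n) (𝓡 m).tangent ∞ (fun v => (⟨φ.symm (D.x v),
        dsymm φ (D.x v) (EuclideanSpace.single j 1)⟩ : TangentBundle (𝓡 m) M)) u := fun j =>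
      (contMDiffAt_dsymm hφ (φ.map_source h3) (EuclideanSpace.single j 1)).comp u
        (hx u hu).contMDiffAt
    have hpr : ∀ᶠ v in nhds u, ι (ψ.symm v) = φ.symm (D.x v) :=
      (hop.eventually_mem hu).mono fun v hv => (φ.left_inv (coordExpr_point hv).2.2).symm
    -- The covariant components of `N_A` are inner products with coordinate fields, hence smooth;
    -- raising the index by the smooth inverse metric gives the components themselves.
    have hF : ∀ j, ContDiffAt ℝ ∞ (fun v => (D.gBar v *ᵥ D.normal A v) j) u := by
      intro j
      refine (contDiffAt_tangentInner gM hN' (hE j) hpr).congr_of_eventuallyEq ?_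
      refine (hop.eventually_mem hu).mono fun v hv => ?_
      have e1 : (D.gBar v *ᵥ D.normal A v) j =
          pairing (D.gBar v) (D.normal A v) (EuclideanSpace.single j (1 : ℝ)).ofLp := by
        have hsymm : (D.gBar v).IsSymm := hmet.symm _ (φ.map_source (coordExpr_point hv).2.2)
        rw [pairing_comm hsymm, pairing_eq_dotProduct]
        simp
      change (D.gBar v *ᵥ D.normal A v) j = _
      rw [e1, hNV v hv]
      rfl
    have hGs : SmoothEntriesAt D.gBar u := fun a b =>
      ContDiffAt.comp (g := fun y => metricInChart gM φ y a b) u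
        (hmet.smooth _ (φ.map_source h3) a b) (hx u hu)
    have hGi := hGs.inv (hmet.det_pos (φ.map_source h3)).ne'
    refine (ContDiffAt.sum fun j (_ : j ∈ Finset.univ) =>
      (hGi i j).mul (hF j)).congr_of_eventuallyEq ?_
    refine (hop.eventually_mem hu).mono fun v hv => ?_
    have e1 : D.normal A v = (D.gBar v)⁻¹ *ᵥ (D.gBar v *ᵥ D.normal A v) := by
      have h : (D.gBar v)⁻¹ * D.gBar v = 1 :=
        hmet.inv_mul (φ.map_source (coordExpr_point hv).2.2)
      rw [mulVec_mulVec, h, one_mulVec]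
    exact congrFun e1 i
  · intro u hu A B
    exact ((hNV u hu A (dchart φ (ι (ψ.symm u)) (N B (ψ.symm u)))).trans
      (congrArg (tangentInner gM _ _) (dsymm_dchart hφ (coordExpr_point hu).2.2 _))).trans
      (hN.orthonormal _ (hmem u hu) A B)
  · intro u hu A a
    rw [he u hu, hNV u hu, dsymm_fderiv hιs hφ hψ hu]
    exact hN.normal _ (hmem u hu) A _
  · intro u hu
    have hinj : Function.Injective (fderiv ℝ (fun v => φ (ι (ψ.symm v))) u) := by
      rw [injective_iff_map_eq_zero]
      intro w hw
      have h := dsymm_fderiv hιs hφ hψ hu w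
      rw [hw, map_zero] at h
      have h1 := mfderiv_injective_of_isImmersionAt (hι.isImmersion.isImmersionAt (ψ.symm u))
      have h2 := (mdifferentiable_of_mem_maximalAtlas hψ).symm.mfderiv_injective
        (coordExpr_point hu).1
      exact h2 ((h1 (h.symm.trans (map_zero _).symm)).trans (map_zero _).symm)
    rw [Fintype.linearIndependent_iff]
    intro c hc b
    set w : EuclideanSpace ℝ (Fin n) := ∑ a, c a • EuclideanSpace.single a 1 with hw
    have h0 : w = 0 := by
      refine hinj (WithLp.ofLp_injective 2 ?_)
      rw [map_zero, hw]
      simp only [map_sum, map_smul, WithLp.ofLp_sum, WithLp.ofLp_smul, ← he u hu, hc,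
        WithLp.ofLp_zero]
    have h1 : w b = c b := by simp [hw, Pi.single_apply]
    rw [← h1, h0]
    rfl

/-- Smooth functions with prescribed partial derivatives at a point. -/
lemma exists_smooth_pd_eq [IsManifold (𝓡 n) ∞ S] [T2Space S]
    (hψ : ψ ∈ IsManifold.maximalAtlas (𝓡 n) ∞ S) {s : S} (hs : s ∈ ψ.source) (c : Fin n) :
    ∃ f : C^∞⟮𝓡 n, S; ℝ⟯, ∀ a, pd (fun u => f (ψ.symm u)) a (ψ s) = if a = c then 1 else 0 := by
  -- A bump function supported in the chart domain, times the coordinate `u^c`, is smooth on all of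
  -- `S` and equals `u^c` near the point.
  obtain ⟨b, -, hb⟩ := (SmoothBumpFunction.nhds_basis_tsupport (I := 𝓡 n) s).mem_iff.1
    (ψ.open_source.mem_nhds hs)
  have hsm : ContMDiff (𝓡 n) 𝓘(ℝ, ℝ) ∞ (fun t => b t * ψ t c) := by
    refine contMDiff_of_tsupport fun t ht => ?_
    have ht' : t ∈ ψ.source := hb (closure_mono (Function.support_mul_subset_left _ _) ht)
    refine b.contMDiff.contMDiffAt.mul ?_
    exact ((EuclideanSpace.proj (𝕜 := ℝ) c).contMDiff.contMDiffAt).comp t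
      ((contMDiffOn_of_mem_maximalAtlas hψ).contMDiffAt (ψ.open_source.mem_nhds ht'))
  refine ⟨⟨_, hsm⟩, fun a => ?_⟩
  have hev : (fun u => b (ψ.symm u) * ψ (ψ.symm u) c) =ᶠ[nhds (ψ s)] fun u => u c := by
    have h1 : Filter.Tendsto ψ.symm (nhds (ψ s)) (nhds s) := by
      have := ψ.continuousAt_symm (ψ.map_source hs)
      rwa [ContinuousAt, ψ.left_inv hs] at this
    filter_upwards [h1.eventually b.eventuallyEq_one,
      ψ.open_target.mem_nhds (ψ.map_source hs)] with u hu hu'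
    rw [ψ.right_inv hu', hu]
    simp
  refine (pd_congr hev a).trans ?_
  have : fderiv ℝ (fun u : EuclideanSpace ℝ (Fin n) => u c) (ψ s) =
      EuclideanSpace.proj (𝕜 := ℝ) c := (EuclideanSpace.proj (𝕜 := ℝ) c).fderiv
  rw [pd, this]
  simp [eq_comm]

end Submanifold

end NambuCodazzi

/-! ### The theorem on manifolds -/

theorem mainTheorem2 {k m p : ℕ} (hm : m = k + 2 + p)
    {M : Type*} [TopologicalSpace M] [T2Space M]
    [ChartedSpace (EuclideanSpace ℝ (Fin m)) M] [IsManifold (𝓡 m) ∞ M]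
    {S : Type*} [TopologicalSpace S]
    [ChartedSpace (EuclideanSpace ℝ (Fin (k + 2))) S] [IsManifold (𝓡 (k + 2)) ∞ S]
    (gM : Metric m M) (ι : S → M) (hι : Manifold.IsSmoothEmbedding (𝓡 (k + 2)) (𝓡 m) ∞ ι)
    (φ : OpenPartialHomeomorph M (EuclideanSpace ℝ (Fin m)))
    (hφ : φ ∈ IsManifold.maximalAtlas (𝓡 m) ∞ M)
    (ψ : OpenPartialHomeomorph S (EuclideanSpace ℝ (Fin (k + 2))))
    (hψ : ψ ∈ IsManifold.maximalAtlas (𝓡 (k + 2)) ∞ S)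
    (N : Fin p → ∀ s : S, TangentSpace (𝓡 m) (ι s))
    (hN : IsNormalFrameOn (k + 2) gM ι N (ψ.source ∩ ι ⁻¹' φ.source))
    (ρ : S → ℝ) (hρ : ∀ s ∈ ψ.source ∩ ι ⁻¹' φ.source, ρ s ≠ 0)
    (D : CoordExpr (k + 2) m p) (hD : D = coordExpr gM ι N φ ψ ρ) :
    -- the identity holds
    (∀ s ∈ ψ.source ∩ ι ⁻¹' φ.source, ∀ A, ∀ f : Fin k → C^∞⟮𝓡 (k + 2), S; ℝ⟯,
      D.NambuIdentity D.W D.normalConn A (inCoords ψ f) (ψ s)) ∧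
    -- it is equivalent to the Codazzi–Mainardi equations
    (∀ s ∈ ψ.source ∩ ι ⁻¹' φ.source, ∀ A,
      D.CodazziMainardi D.h D.normalConn A (ψ s) ↔
        ∀ f : Fin k → C^∞⟮𝓡 (k + 2), S; ℝ⟯,
          D.NambuIdentity D.W D.normalConn A (inCoords ψ f) (ψ s)) ∧
    -- the equivalence is formal: it holds for arbitrary fields of endomorphisms `W_B` and
    -- one-forms `θ_BA`, with `h_B(X, Y) = g(W_B(X), Y)`
    (∀ (W : Fin p → EuclideanSpace ℝ (Fin (k + 2)) → Matrix (Fin (k + 2)) (Fin (k + 2)) ℝ)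
      (θ : Fin p → Fin p → EuclideanSpace ℝ (Fin (k + 2)) → Fin (k + 2) → ℝ),
      (∀ B a b, ContDiffOn ℝ ∞ (fun u => W B u a b) (ψ '' (ψ.source ∩ ι ⁻¹' φ.source))) →
      ∀ s ∈ ψ.source ∩ ι ⁻¹' φ.source, ∀ A,
        D.CodazziMainardi (fun B u => (W B u).transpose * D.g u) θ A (ψ s) ↔
          ∀ f : Fin k → C^∞⟮𝓡 (k + 2), S; ℝ⟯,
            D.NambuIdentity W θ A (inCoords ψ f) (ψ s)) ∧
    -- the case of constant curvature
    (∀ K : ℝ, HasConstantCurvature gM K →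
      ∀ s ∈ ψ.source ∩ ι ⁻¹' φ.source, ∀ A, ∀ f : Fin k → C^∞⟮𝓡 (k + 2), S; ℝ⟯,
        D.calC D.W D.normalConn A (inCoords ψ f) (ψ s) = 0) := by
  subst hD
  set D := coordExpr gM ι N φ ψ ρ with hD
  have hreg : D.IsRegular φ.target (ψ '' (ψ.source ∩ ι ⁻¹' φ.source)) :=
    isRegular_coordExpr hι hφ hψ hN
  have hmem : ∀ s ∈ ψ.source ∩ ι ⁻¹' φ.source, ψ s ∈ ψ '' (ψ.source ∩ ι ⁻¹' φ.source) :=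
    fun s hs => Set.mem_image_of_mem ψ hs
  have hdens : ∀ s ∈ ψ.source ∩ ι ⁻¹' φ.source, D.density (ψ s) ≠ 0 := fun s hs => by
    change ρ (ψ.symm (ψ s)) ≠ 0
    rw [ψ.left_inv hs.1]
    exact hρ s hs
  -- The bump functions live on a Hausdorff space; `S` inherits this from `M`.
  have : T2Space S := hι.isEmbedding.t2Space
  have hformal : ∀ (W : Fin p → EuclideanSpace ℝ (Fin (k + 2)) →
        Matrix (Fin (k + 2)) (Fin (k + 2)) ℝ)
      (θ : Fin p → Fin p → EuclideanSpace ℝ (Fin (k + 2)) → Fin (k + 2) → ℝ),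
      ∀ s ∈ ψ.source ∩ ι ⁻¹' φ.source, ∀ A, SmoothEntriesAt (W A) (ψ s) →
        (D.CodazziMainardi (fun B u => (W B u).transpose * D.g u) θ A (ψ s) ↔
          ∀ f : Fin k → C^∞⟮𝓡 (k + 2), S; ℝ⟯,
            D.NambuIdentity W θ A (inCoords ψ f) (ψ s)) := by
    intro W θ s hs A hW
    have h := hreg.codazziMainardi_iff_nambuIdentity (hmem s hs) (hdens s hs) θ hW
      (𝓕 := Set.range (inCoords ψ)) (fun c => ?_)
    · rw [h, Set.forall_mem_range]
    · choose f hf using fun l => exists_smooth_pd_eq hψ hs.1 (c l)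
      exact ⟨_, ⟨f, rfl⟩, hf⟩
  have hcod : ∀ s ∈ ψ.source ∩ ι ⁻¹' φ.source, ∀ A,
      D.CodazziMainardi D.h D.normalConn A (ψ s) := fun s hs A =>
    hreg.codazziMainardi hm (hmem s hs) A
  have hequiv : ∀ s ∈ ψ.source ∩ ι ⁻¹' φ.source, ∀ A,
      (D.CodazziMainardi D.h D.normalConn A (ψ s) ↔
        ∀ f : Fin k → C^∞⟮𝓡 (k + 2), S; ℝ⟯,
          D.NambuIdentity D.W D.normalConn A (inCoords ψ f) (ψ s)) := fun s hs A => by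
    rw [← hformal D.W D.normalConn s hs A (hreg.smooth_W (hmem s hs) A),
      hreg.codazziMainardi_h_iff (hmem s hs)]
  -- The first assertion is the equivalence applied to the classical Codazzi–Mainardi equation.
  refine ⟨fun s hs A => (hequiv s hs A).1 (hcod s hs A), hequiv, ?_, ?_⟩
  · intro W θ hW s hs A
    exact hformal W θ s hs A fun a b =>
      (hW A a b).contDiffAt (hreg.isOpen.mem_nhds (hmem s hs))
  · intro K hK s hs A f
    have hu := hmem s hs
    refine hreg.calC_eq_zero hm hu A (fun a b c => ?_) _
    have h : pairing (D.gBar (ψ s)) (curvature D.metric (D.x (ψ s)) (D.e a (ψ s)) (D.e b (ψ s))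
        (D.e c (ψ s))) (D.normal A (ψ s)) = _ :=
      hreg.metric.curvature_of_const (hreg.mem _ hu) (hK φ hφ _ (hreg.mem _ hu)) _ _ _ _
    -- Each term of the constant-curvature formula contains the pairing of a tangent vector with
    -- `N_A`.
    have hne : ∀ a, pairing (D.metric (D.x (ψ s))) (D.e a (ψ s)) (D.normal A (ψ s)) = 0 :=
      fun a => (pairing_comm (hreg.gBar_symm hu) _ _).trans (hreg.normal_e _ hu A a)
    rw [h, hne, hne]
    ring
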